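/- Let $\mathcal T$ be an (elementary) topos, i.e. a category with finite limits, exponentials and a subobject classifier $\Omega$. Call a class $\mathcal W$ of morphisms of $\mathcal T$ a logical class if (i) $\mathcal W$ contains all isomorphisms and is closed under composition and under pullback along arbitrary morphisms; (ii) $\mathcal W$ contains all epimorphisms; (iii) the mono part of every $w\in\mathcal W$ (in its epi–mono factorization) lies in $\mathcal W$; (iv) whenever $m:U\to V$ is a monomorphism in $\mathcal W$, $f:V\to X$ is a monomorphism and $g:X\to Y$ is any morphism, the induced inclusion $\forall_g m:\forall_g(fm)\to\forall_g f$ of subobjects of $Y$ lies in $\mathcal W$, where $\forall_g$ is the right adjoint of pulling back subobjects along $g$. Let $\mathcal B(\mathcal T)$ be the least logical class containing the canonical morphism $b=[\mathrm{true},\mathrm{false}]:1+1\to\Omega$. For a logical class $\mathcal W$ let $\mathsf{Span}_{\mathcal W}(\mathcal T)$ be the category with the objects of $\mathcal T$, whose morphisms $A\to B$ are the classes $[s,f]$ of spans $A\xleftarrow{s}D\xrightarrow{f}B$ in $\mathcal T$ for the equivalence relation generated by $(s'x,f'x)\sim(s',f')$ for $x\in\mathcal W$, with composition by pullback. It is an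 allegory: the involution is $[s,f]^\circ=[f,s]$, the intersection of two classes of spans from $A$ to $B$ is the class of their pullback over $A\times B$, and $\varphi\le\psi$ means $\varphi\cap\psi=\varphi$. Let $\mathsf{Map}(\mathsf{Span}_{\mathcal W}(\mathcal T))$ be its category of maps: it has the same objects, and its morphisms are the $\varphi:A\to B$ with $1_A\le\varphi^\circ\varphi$ and $\varphi\varphi^\circ\le 1_B$. Then for every topos $\mathcal T$ the category $\mathsf{Map}(\mathsf{Span}_{\mathcal B(\mathcal T)}(\mathcal T))$ is a Boolean topos, i.e. it is a topos in which the canonical morphism $1+1\to\Omega$ is an isomorphism. -/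

import Mathlib

open CategoryTheory CategoryTheory.Limits

universe v u

namespace SpanTopos

section Toposes

/-- An (elementary) topos: a category with finite limits, in which every functor `A × -` has a
right adjoint (exponentials), and which has a subobject classifier. -/
class IsElementaryTopos (C : Type u) [Category.{v} C] : Prop where
  hasFiniteLimits : HasFiniteLimits C
  exponentiable : ∀ A : C, (prod.functor.obj A).IsLeftAdjoint
  hasSubobjectClassifier : HasSubobjectClassifier C

attribute [instance] IsElementaryTopos.hasFiniteLimits

variable {C : Type u} [Category.{v} C]

/-- `f : 1 ⟶ Ω` is the truth value "false": the characteristic map of `0 ↪ 1`. -/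
def IsFalsity (K : Subobject.Classifier C) (f : K.Ω₀ ⟶ K.Ω) : Prop :=
  ∃ (Z : C) (hZ : IsInitial Z), IsPullback (hZ.to K.Ω₀) (hZ.to K.Ω₀) f K.truth

/-- `b : S ⟶ Ω` is the canonical map `1 + 1 ⟶ Ω`: its source is a coproduct of two copies of the
terminal object, and `b` is the copairing of "true" and "false". -/
def IsBoolMap (K : Subobject.Classifier C) {S : C} (b : S ⟶ K.Ω) : Prop :=
  ∃ (i j : K.Ω₀ ⟶ S), Nonempty (IsColimit (BinaryCofan.mk i j)) ∧
    i ≫ b = K.truth ∧ IsFalsity K (j ≫ b)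

/-- A Boolean topos: a topos for which the canonical map `1 + 1 ⟶ Ω` is an isomorphism. -/
class IsBooleanTopos (C : Type u) [Category.{v} C] : Prop extends IsElementaryTopos C where
  boolean : ∃ (K : Subobject.Classifier C) (S : C) (b : S ⟶ K.Ω), IsBoolMap K b ∧ IsIso b

end Toposes

section Allegories

/-- An allegory: the hom-sets are posets with binary meets, composition is monotone (so that one
has a locally ordered 2-category), and there is an identity-on-objects order-preserving
contravariant involution satisfying the modular law. -/
class Allegory (A : Type u) [Category.{v} A] where
  homSemilatticeInf : ∀ X Y : A, SemilatticeInf (X ⟶ Y)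
  recip : ∀ {X Y : A}, (X ⟶ Y) → (Y ⟶ X)
  comp_mono : ∀ {X Y Z : A} {φ φ' : X ⟶ Y} {ψ ψ' : Y ⟶ Z}, φ ≤ φ' → ψ ≤ ψ' → φ ≫ ψ ≤ φ' ≫ ψ'
  recip_mono : ∀ {X Y : A} {φ φ' : X ⟶ Y}, φ ≤ φ' → recip φ ≤ recip φ'
  recip_recip : ∀ {X Y : A} (φ : X ⟶ Y), recip (recip φ) = φ
  recip_id : ∀ X : A, recip (𝟙 X) = 𝟙 X
  recip_comp : ∀ {X Y Z : A} (φ : X ⟶ Y) (ψ : Y ⟶ Z), recip (φ ≫ ψ) = recip ψ ≫ recip φ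
  modular : ∀ {X Y Z : A} (φ : X ⟶ Y) (ψ : Y ⟶ Z) (χ : X ⟶ Z),
    (φ ≫ ψ) ⊓ χ ≤ φ ≫ (ψ ⊓ (recip φ ≫ χ))

attribute [reducible, instance] Allegory.homSemilatticeInf

/-- The class of maps of an allegory: the morphisms `φ` that are entire (`1 ≤ φ° φ`) and simple
(`φ φ° ≤ 1`). -/
def maps (A : Type u) [Category.{v} A] [Allegory A] : MorphismProperty A :=
  fun _ _ φ => 𝟙 _ ≤ φ ≫ Allegory.recip φ ∧ Allegory.recip φ ≫ φ ≤ 𝟙 _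

instance (A : Type u) [Category.{v} A] [Allegory A] : (maps A).IsMultiplicative where
  id_mem X := by simp [maps, Allegory.recip_id]
  comp_mem {X Y Z} f g hf hg := by
    constructor
    · calc 𝟙 X ≤ f ≫ Allegory.recip f := hf.1
        _ = f ≫ 𝟙 Y ≫ Allegory.recip f := by simp
        _ ≤ f ≫ (g ≫ Allegory.recip g) ≫ Allegory.recip f :=
          Allegory.comp_mono le_rfl (Allegory.comp_mono hg.1 le_rfl)
        _ = (f ≫ g) ≫ Allegory.recip (f ≫ g) := by simp [Allegory.recip_comp]
    · calc Allegory.recip (f ≫ g) ≫ f ≫ g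
          = Allegory.recip g ≫ (Allegory.recip f ≫ f) ≫ g := by simp [Allegory.recip_comp]
        _ ≤ Allegory.recip g ≫ 𝟙 Y ≫ g :=
          Allegory.comp_mono le_rfl (Allegory.comp_mono hf.2 le_rfl)
        _ = Allegory.recip g ≫ g := by simp
        _ ≤ 𝟙 Z := hg.2

/-- The category of maps of an allegory: same objects, with the maps as morphisms. -/
abbrev MapCat (A : Type u) [Category.{v} A] [Allegory A] := WideSubcategory (maps A)

end Allegories

section LogicalClasses

variable {C : Type u} [Category.{v} C] [HasPullbacks C]

/-- `n : P ⟶ Y` represents the subobject `∀_g f` of `Y`, for a monomorphism `f : U ⟶ X` and a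
morphism `g : X ⟶ Y`, where `∀_g` is right adjoint to pulling back subobjects along `g`. -/
def IsForall {U X Y P : C} (g : X ⟶ Y) (f : U ⟶ X) [Mono f] (n : P ⟶ Y) [Mono n] : Prop :=
  ∀ R : Subobject Y, R ≤ Subobject.mk n ↔ (Subobject.pullback g).obj R ≤ Subobject.mk f

/-- A logical class of morphisms. In `forall_mem`, the morphism `m'` is the inclusion
`∀_g (f m) ≤ ∀_g f` induced by the inclusion `m` of subobjects `f m ≤ f`. -/
class IsLogicalClass (W : MorphismProperty C) : Prop extends
    W.IsStableUnderComposition, W.IsStableUnderBaseChange where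
  iso_mem : ∀ {X Y : C} (f : X ⟶ Y) [IsIso f], W f
  epi_mem : ∀ {X Y : C} (f : X ⟶ Y) [Epi f], W f
  mono_part_mem : ∀ {X I Y : C} (e : X ⟶ I) (m : I ⟶ Y) [Epi e] [Mono m], W (e ≫ m) → W m
  forall_mem : ∀ {U V X Y P Q : C} (m : U ⟶ V) (f : V ⟶ X) (g : X ⟶ Y) [Mono m] [Mono f]
    (n : P ⟶ Y) (k : Q ⟶ Y) [Mono n] [Mono k] (m' : P ⟶ Q),
    IsForall g (m ≫ f) n → IsForall g f k → m' ≫ k = n → W m → W m'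

instance (W : MorphismProperty C) [IsLogicalClass W] : W.IsMultiplicative where
  id_mem X := IsLogicalClass.iso_mem (𝟙 X)

/-- The class contains the canonical map `b : 1 + 1 ⟶ Ω`. -/
def ContainsBoolMap (W : MorphismProperty C) : Prop :=
  ∀ (K : Subobject.Classifier C) (S : C) (b : S ⟶ K.Ω), IsBoolMap K b → W b

variable (C) in
/-- The least logical class of morphisms containing the canonical map `b : 1 + 1 ⟶ Ω`. -/
def boolClass : MorphismProperty C :=
  fun _ _ f => ∀ W : MorphismProperty C, IsLogicalClass W → ContainsBoolMap W → W f

instance : IsLogicalClass (boolClass C) where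
  comp_mem f g hf hg W hW hb := W.comp_mem f g (hf W hW hb) (hg W hW hb)
  of_isPullback sq hg W hW hb := W.of_isPullback sq (hg W hW hb)
  iso_mem f _ _ hW _ := hW.iso_mem f
  epi_mem f _ _ hW _ := hW.epi_mem f
  mono_part_mem e m _ _ h W hW hb := hW.mono_part_mem e m (h W hW hb)
  forall_mem m f g _ _ n k _ _ m' h₁ h₂ h₃ h W hW hb :=
    hW.forall_mem m f g n k m' h₁ h₂ h₃ (h W hW hb)

theorem containsBoolMap_boolClass : ContainsBoolMap (boolClass C) :=
  fun K S b hb _ _ hW => hW K S b hb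

theorem boolClass_le (W : MorphismProperty C) [hW : IsLogicalClass W] (hb : ContainsBoolMap W) :
    boolClass C ≤ W :=
  fun _ _ _ hf => hf W hW hb

end LogicalClasses

noncomputable section Spans

variable {C : Type u} [Category.{v} C]

/-- Spans `A ⟵ D ⟶ B` in `C`, with arbitrary legs. -/
abbrev Sp (A B : C) := Span (⊤ : MorphismProperty C) (⊤ : MorphismProperty C) A B

/-- The span `A ⟵ D ⟶ B` with legs `s` and `f`. -/
abbrev Sp.mk {A B D : C} (s : D ⟶ A) (f : D ⟶ B) : Sp A B := ⟨D, s, f, trivial, trivial⟩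

/-- The identity span. -/
abbrev Sp.id (A : C) : Sp A A := Sp.mk (𝟙 A) (𝟙 A)

/-- Composition of spans by pullback. -/
abbrev Sp.comp [HasPullbacks C] {A B D : C} (s : Sp A B) (t : Sp B D) : Sp A D :=
  Sp.mk (pullback.fst s.r t.l ≫ s.l) (pullback.snd s.r t.l ≫ t.r)

/-- The opposite span. -/
abbrev Sp.recip {A B : C} (s : Sp A B) : Sp B A := Sp.mk s.r s.l

/-- The intersection of two spans from `A` to `B`: their pullback over `A × B`. -/
abbrev Sp.inter [HasFiniteLimits C] {A B : C} (s t : Sp A B) : Sp A B :=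
  Sp.mk (pullback.fst (prod.lift s.l s.r) (prod.lift t.l t.r) ≫ s.l)
    (pullback.fst (prod.lift s.l s.r) (prod.lift t.l t.r) ≫ s.r)

/-- `(s, f) ≤ (s', f')` with respect to a class `W` of morphisms: there is a morphism of spans
from `(s, f)` to `(s', f')` that lies in `W`. -/
def Sp.Le (W : MorphismProperty C) {A B : C} (s t : Sp A B) : Prop :=
  ∃ x : s ⟶ t, W x.hom

/-- The quotient of the category of spans in `C` by the equivalence relation generated by
`Sp.Le W`. -/
structure SpanCat (W : MorphismProperty C) where
  obj : C

namespace SpanCat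

variable {W : MorphismProperty C}

/-- Equivalence classes of spans for the equivalence relation generated by `Sp.Le W`. -/
def Hom (W : MorphismProperty C) (A B : C) := Quot (Sp.Le W (A := A) (B := B))

/-- The class of a span. -/
def cls (W : MorphismProperty C) {A B : C} (s : Sp A B) : Hom W A B := Quot.mk _ s

theorem cls_eq {A B : C} {s t : Sp A B} (x : s.apex ⟶ t.apex) (hl : x ≫ t.l = s.l)
    (hr : x ≫ t.r = s.r) (hx : W x) : cls W s = cls W t :=
  Quot.sound ⟨⟨x, hl, hr⟩, hx⟩

section Composition

variable [HasPullbacks C] [W.IsMultiplicative] [W.IsStableUnderBaseChange]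

/-- Composition of classes of spans. -/
def comp {A B D : C} : Hom W A B → Hom W B D → Hom W A D :=
  Quot.lift₂ (fun s t => cls W (Sp.comp s t))
    (fun s t t' ⟨y, hy⟩ => cls_eq
      (pullback.map s.r t.l s.r t'.l (𝟙 _) y.hom (𝟙 _) (by simp) (by simp))
      ((pullback.lift_fst_assoc _ _ _ _).trans (by simp))
      ((pullback.lift_snd_assoc _ _ _ _).trans (by simp))
      (W.pullbackMap (W.id_mem _) hy (by simp) (by simp)))
    (fun s s' t ⟨x, hx⟩ => cls_eq
      (pullback.map s.r t.l s'.r t.l x.hom (𝟙 _) (𝟙 _) (by simp) (by simp))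
      ((pullback.lift_fst_assoc _ _ _ _).trans (by simp))
      ((pullback.lift_snd_assoc _ _ _ _).trans (by simp))
      (W.pullbackMap hx (W.id_mem _) (by simp) (by simp)))

instance : Category.{max u v} (SpanCat W) where
  Hom A B := Hom W A.obj B.obj
  id A := cls W (Sp.id A.obj)
  comp φ ψ := comp φ ψ
  id_comp := by
    rintro A B ⟨s⟩
    exact cls_eq (pullback.snd _ _) (by simp [← pullback.condition]) (by simp)
      (MorphismProperty.of_isIso W _)
  comp_id := by
    rintro A B ⟨s⟩
    exact cls_eq (pullback.fst _ _) (by simp) (by simp [pullback.condition])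
      (MorphismProperty.of_isIso W _)
  assoc := by
    rintro A B D E ⟨s⟩ ⟨t⟩ ⟨w⟩
    exact cls_eq (pullbackAssoc s.r t.l t.r w.l).hom (by simp) (by simp)
      (MorphismProperty.of_isIso W _)

end Composition

section AllegoryStructure

variable [HasFiniteLimits C]

/-- The class of the opposite span. -/
def recip {A B : C} : Hom W A B → Hom W B A :=
  Quot.lift (fun s => cls W (Sp.recip s))
    (fun _ _ ⟨x, hx⟩ => cls_eq x.hom x.hom_r x.hom_l hx)

theorem inter_condition {A B : C} (s t : Sp A B) :
    pullback.fst (prod.lift s.l s.r) (prod.lift t.l t.r) ≫ s.l =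
      pullback.snd (prod.lift s.l s.r) (prod.lift t.l t.r) ≫ t.l ∧
    pullback.fst (prod.lift s.l s.r) (prod.lift t.l t.r) ≫ s.r =
      pullback.snd (prod.lift s.l s.r) (prod.lift t.l t.r) ≫ t.r := by
  have h := pullback.condition (f := prod.lift s.l s.r) (g := prod.lift t.l t.r)
  have h₁ := h =≫ (prod.fst : A ⨯ B ⟶ A)
  have h₂ := h =≫ (prod.snd : A ⨯ B ⟶ B)
  rw [Category.assoc, Category.assoc, prod.lift_fst, prod.lift_fst] at h₁
  rw [Category.assoc, Category.assoc, prod.lift_snd, prod.lift_snd] at h₂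
  exact ⟨h₁, h₂⟩

/-- First projection from the intersection. -/
def interFst {A B : C} (s t : Sp A B) : Sp.inter s t ⟶ s where
  hom := pullback.fst _ _

/-- Second projection from the intersection. -/
def interSnd {A B : C} (s t : Sp A B) : Sp.inter s t ⟶ t where
  hom := pullback.snd _ _
  hom_l := (inter_condition s t).1.symm
  hom_r := (inter_condition s t).2.symm

/-- Universal property of the intersection. -/
def interLift {A B : C} {w s t : Sp A B} (x : w ⟶ s) (y : w ⟶ t) : w ⟶ Sp.inter s t where
  hom := pullback.lift x.hom y.hom (by ext <;> simp)
  hom_l := (pullback.lift_fst_assoc _ _ _ _).trans x.hom_l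
  hom_r := (pullback.lift_fst_assoc _ _ _ _).trans x.hom_r

/-- Universal property of the composite. -/
def compLift {A B D : C} {w : Sp A D} {s : Sp A B} {t : Sp B D} (x : w.apex ⟶ s.apex)
    (y : w.apex ⟶ t.apex) (h : x ≫ s.r = y ≫ t.l) (hl : x ≫ s.l = w.l) (hr : y ≫ t.r = w.r) :
    w ⟶ Sp.comp s t where
  hom := pullback.lift x y h
  hom_l := (pullback.lift_fst_assoc _ _ _ _).trans hl
  hom_r := (pullback.lift_snd_assoc _ _ _ _).trans hr

/-- Functoriality of composition. -/
def compMap {A B D : C} {s s' : Sp A B} {t t' : Sp B D} (x : s ⟶ s') (y : t ⟶ t') :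
    Sp.comp s t ⟶ Sp.comp s' t' :=
  compLift (pullback.fst _ _ ≫ x.hom) (pullback.snd _ _ ≫ y.hom)
    (by simp [pullback.condition]) (by simp) (by simp)

variable [hW : IsLogicalClass W]

theorem cls_inter_of_hom {A B : C} {s t : Sp A B} (x : s ⟶ t) :
    cls W (Sp.inter s t) = cls W s := by
  have h : (interLift (𝟙 s) x).hom ≫ (interFst s t).hom = 𝟙 _ := pullback.lift_fst _ _ _
  have : IsSplitEpi (interFst s t).hom := ⟨⟨⟨_, h⟩⟩⟩
  exact cls_eq (interFst s t).hom (interFst s t).hom_l (interFst s t).hom_r (hW.epi_mem _)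

theorem cls_inter_of_hom' {A B : C} {s t : Sp A B} (x : t ⟶ s) :
    cls W (Sp.inter s t) = cls W t := by
  have h : (interLift x (𝟙 t)).hom ≫ (interSnd s t).hom = 𝟙 _ := pullback.lift_snd _ _ _
  have : IsSplitEpi (interSnd s t).hom := ⟨⟨⟨_, h⟩⟩⟩
  exact cls_eq (interSnd s t).hom (interSnd s t).hom_l (interSnd s t).hom_r (hW.epi_mem _)

theorem cls_eq_of_homs {A B : C} {s t : Sp A B} (x : s ⟶ t) (y : t ⟶ s) :
    cls W s = cls W t :=
  (cls_inter_of_hom x).symm.trans (cls_inter_of_hom' y)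

/-- Intersection of classes of spans. -/
def inter {A B : C} : Hom W A B → Hom W A B → Hom W A B :=
  Quot.lift₂ (fun s t => cls W (Sp.inter s t))
    (fun s t t' ⟨y, hy⟩ => cls_eq
      (pullback.map _ _ _ _ (𝟙 _) y.hom (𝟙 _) (by simp) (by ext <;> simp))
      ((pullback.lift_fst_assoc _ _ _ _).trans (by simp))
      ((pullback.lift_fst_assoc _ _ _ _).trans (by simp))
      (W.pullbackMap (W.id_mem _) hy (by simp) (by ext <;> simp)))
    (fun s s' t ⟨x, hx⟩ => cls_eq
      (pullback.map _ _ _ _ x.hom (𝟙 _) (𝟙 _) (by ext <;> simp) (by simp))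
      ((pullback.lift_fst_assoc _ _ _ _).trans (by simp))
      ((pullback.lift_fst_assoc _ _ _ _).trans (by simp))
      (W.pullbackMap hx (W.id_mem _) (by ext <;> simp) (by simp)))

/-- The order on classes of spans is the one defined by intersection: `φ ≤ ψ` if and only if
`ψ ∩ φ = φ`. -/
@[reducible] def homSemilatticeInf (A B : SpanCat W) : SemilatticeInf (A ⟶ B) :=
  letI : Min (A ⟶ B) := ⟨fun φ ψ => inter φ ψ⟩
  SemilatticeInf.mk'
    (by
      rintro ⟨s⟩ ⟨t⟩
      exact cls_eq_of_homs (interLift (interSnd s t) (interFst s t))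
        (interLift (interSnd t s) (interFst t s)))
    (by
      rintro ⟨s⟩ ⟨t⟩ ⟨w⟩
      exact cls_eq_of_homs
        (interLift (interFst _ _ ≫ interFst _ _)
          (interLift (interFst _ _ ≫ interSnd _ _) (interSnd _ _)))
        (interLift (interLift (interFst _ _) (interSnd _ _ ≫ interFst _ _))
          (interSnd _ _ ≫ interSnd _ _)))
    (by
      rintro ⟨s⟩
      exact cls_inter_of_hom (𝟙 s))

attribute [local instance] homSemilatticeInf

theorem cls_le_of_hom {A B : SpanCat W} {s t : Sp A.obj B.obj} (x : s ⟶ t) :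
    (show A ⟶ B from cls W s) ≤ (show A ⟶ B from cls W t) :=
  cls_inter_of_hom' x

theorem exists_hom_of_le {A B : SpanCat W} {φ ψ : A ⟶ B} (h : φ ≤ ψ) :
    ∃ s t : Sp A.obj B.obj, cls W s = φ ∧ cls W t = ψ ∧ Nonempty (s ⟶ t) := by
  obtain ⟨s⟩ := φ
  obtain ⟨t⟩ := ψ
  exact ⟨Sp.inter t s, t, h, rfl, ⟨interFst t s⟩⟩

/-- The quotient of the category of spans by a logical class is an allegory. -/
instance : Allegory (SpanCat W) where
  homSemilatticeInf := homSemilatticeInf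
  recip φ := recip φ
  comp_mono h h' := by
    obtain ⟨s, t, rfl, rfl, ⟨x⟩⟩ := exists_hom_of_le h
    obtain ⟨s', t', rfl, rfl, ⟨y⟩⟩ := exists_hom_of_le h'
    exact cls_le_of_hom (compMap x y)
  recip_mono {A B} _ _ h := by
    obtain ⟨s, t, rfl, rfl, ⟨x⟩⟩ := exists_hom_of_le h
    exact cls_le_of_hom (A := B) (B := A) (s := Sp.recip s) (t := Sp.recip t)
      ⟨x.hom, x.hom_r, x.hom_l⟩
  recip_recip := by
    rintro A B ⟨s⟩
    rfl
  recip_id _ := rfl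
  recip_comp := by
    rintro A B D ⟨s⟩ ⟨t⟩
    exact cls_eq (pullbackSymmetry _ _).hom (by simp) (by simp) (hW.iso_mem _)
  modular := by
    rintro A B D ⟨s⟩ ⟨t⟩ ⟨w⟩
    have h := inter_condition (Sp.comp s t) w
    let r : Sp B.obj D.obj := Sp.mk (pullback.fst _ _ ≫ pullback.fst _ _ ≫ s.r)
      (pullback.snd (prod.lift (Sp.comp s t).l (Sp.comp s t).r) (prod.lift w.l w.r) ≫ w.r)
    let x : r ⟶ t := ⟨pullback.fst _ _ ≫ pullback.snd _ _, by simp [r, pullback.condition],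
      by simpa [r] using h.2⟩
    let y : r ⟶ Sp.comp (Sp.recip s) w :=
      compLift (pullback.fst _ _ ≫ pullback.fst _ _) (pullback.snd _ _)
        (by simpa using h.1) (by simp [r]) (by simp [r])
    exact cls_le_of_hom (compLift (pullback.fst _ _ ≫ pullback.fst _ _) (interLift x y).hom
      ((Category.assoc _ _ _).trans (interLift x y).hom_l.symm) (Category.assoc _ _ _)
      ((interLift x y).hom_r.trans h.2.symm))

end AllegoryStructure

end SpanCat

end Spans

end SpanTopos

/-! Let β be the subterminal object `∀_{Ω→1} b`, the truth value of "every proposition is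
decidable". The logical class generated by `b` does nothing but force β to be true, so the category
of maps is the open subtopos of the objects lying over β, and that subtopos is Boolean. Condition
(iv), applied to `b ≤ 1_Ω` along `Ω → 1`, puts `β → 1` into the class. Conversely, the morphisms
that are covering over β form a logical class containing `b` (`isLogicalClass_coveringAbove`), which
therefore bounds the least one from above. `exists_decidability` collects both halves. The
equivalence sends a morphism to its graph. It is essentially surjective because `β × X → X` is a
mono of the class, and such monos have invertible graphs. It is full and faithful because over β
equivalent spans lie in the same subobjects of `A × B` (`factors_iff_of_cls_eq`), so that a map is
the graph of a unique morphism. Over β the morphism `b` is invertible (`isBooleanTopos_below`).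
Unions, images, the initial object and `1 + 1` are obtained from the classifier and exponentials by
impredicative encodings, tested on generalized elements. -/

namespace SpanTopos

/-! ### Internal logic: comprehension, universal quantification, unions and images. -/

section InternalLogic

variable {C : Type u} [Category.{v} C]

/-- A generalized element of `Ω` is constantly true. -/
def Holds (K : Subobject.Classifier C) {T : C} (p : T ⟶ K.Ω) : Prop :=
  p = K.χ₀ T ≫ K.truth

theorem holds_of_lift {K : Subobject.Classifier C} {T : C} (t : T ⟶ K.Ω₀) :
    Holds K (t ≫ K.truth) := by
  rw [Holds]
  congr 1
  exact K.isTerminalΩ₀.hom_ext _ _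

theorem holds_χ_iff (K : Subobject.Classifier C) {U X T : C} (u : U ⟶ X) [Mono u] (t : T ⟶ X) :
    Holds K (t ≫ K.χ u) ↔ ∃ l, l ≫ u = t := by
  constructor
  · intro h
    exact ⟨(K.isPullback u).lift t (K.χ₀ T) h, (K.isPullback u).lift_fst _ _ _⟩
  · rintro ⟨l, rfl⟩
    rw [Category.assoc, (K.isPullback u).w, ← Category.assoc]
    exact holds_of_lift _

/-- The subobject classified by a morphism to `Ω`. -/
theorem exists_comprehension [HasPullbacks C] (K : Subobject.Classifier C) {X : C} (p : X ⟶ K.Ω) :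
    ∃ (U : C) (u : U ⟶ X) (_ : Mono u),
      ∀ ⦃T : C⦄ (t : T ⟶ X), (∃ l, l ≫ u = t) ↔ Holds K (t ≫ p) := by
  obtain ⟨U, u, _, rfl⟩ := K.surjective_χ p
  exact ⟨U, u, inferInstance, fun T t => (holds_χ_iff K u t).symm⟩

/-- Propositional extensionality: `p` classifies some `u`, and the hypothesis makes `u` a pullback
of truth along `q` as well. -/
theorem classifier_hom_ext [HasPullbacks C] (K : Subobject.Classifier C) {X : C} {p q : X ⟶ K.Ω}
    (h : ∀ ⦃T : C⦄ (t : T ⟶ X), Holds K (t ≫ p) ↔ Holds K (t ≫ q)) : p = q := by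
  obtain ⟨U, u, _, rfl⟩ := K.surjective_χ p
  refine (K.uniq u (χ₀' := K.χ₀ U) ⟨⟨?_⟩, ⟨PullbackCone.IsLimit.mk _
    (fun s => (K.isPullback u).lift s.fst s.snd ?_) ?_ ?_ ?_⟩⟩).symm
  · exact (h u).1 ((holds_χ_iff K u u).2 ⟨𝟙 U, Category.id_comp u⟩)
  · have : Holds K (s.fst ≫ q) := by rw [s.condition]; exact holds_of_lift _
    rw [(h s.fst).2 this]
    congr 1
    exact K.isTerminalΩ₀.hom_ext _ _
  · intro s
    exact (K.isPullback u).lift_fst _ _ _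
  · intro s
    exact K.isTerminalΩ₀.hom_ext _ _
  · intro s m hm _
    rw [← cancel_mono u, hm, (K.isPullback u).lift_fst]

/-- The subobject is the equalizer of the two transposes; naturality of transposition gives its
universal property. -/
theorem exists_equalizer_of_adjunction [HasEqualizers C] {F G : C ⥤ C}
    (adj : F ⊣ G) {Y Z : C} (a b : F.obj Y ⟶ Z) :
    ∃ (P : C) (n : P ⟶ Y) (_ : Mono n), ∀ ⦃T : C⦄ (t : T ⟶ Y), (∃ l, l ≫ n = t) ↔
      F.map t ≫ a = F.map t ≫ b := by
  refine ⟨_, equalizer.ι (adj.homEquiv Y Z a) (adj.homEquiv Y Z b), inferInstance, fun T t => ?_⟩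
  rw [← (adj.homEquiv T Z).injective.eq_iff, adj.homEquiv_naturality_left,
    adj.homEquiv_naturality_left]
  constructor
  · rintro ⟨l, rfl⟩
    rw [Category.assoc, equalizer.condition, Category.assoc]
  · exact fun h => ⟨equalizer.lift t h, equalizer.lift_ι _ _⟩

/-- The subobject of those elements of `Y` at which two families of morphisms on `X` agree. -/
theorem exists_equalizer_family [IsElementaryTopos C] {X Y Z : C} (a b : X ⨯ Y ⟶ Z) :
    ∃ (P : C) (n : P ⟶ Y) (_ : Mono n), ∀ ⦃T : C⦄ (t : T ⟶ Y), (∃ l, l ≫ n = t) ↔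
      prod.map (𝟙 X) t ≫ a = prod.map (𝟙 X) t ≫ b :=
  have := IsElementaryTopos.exponentiable X
  exists_equalizer_of_adjunction (Adjunction.ofIsLeftAdjoint (prod.functor.obj X)) a b

/-- Universal quantification of a subobject along an arbitrary morphism, with its stable universal
property. -/
theorem exists_forall [IsElementaryTopos C] {U X Y : C} (g : X ⟶ Y) (u : U ⟶ X) [Mono u] :
    ∃ (P : C) (n : P ⟶ Y) (_ : Mono n), ∀ ⦃T : C⦄ (t : T ⟶ Y), (∃ l, l ≫ n = t) ↔
      ∀ ⦃Z : C⦄ (z : Z ⟶ T) (x : Z ⟶ X), x ≫ g = z ≫ t → ∃ l, l ≫ u = x := by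
  obtain ⟨⟨K⟩⟩ := IsElementaryTopos.hasSubobjectClassifier (C := C)
  have hmono : Mono (prod.lift (𝟙 X) g) := by
    have : Mono (prod.lift (𝟙 X) g ≫ prod.fst) := by rw [prod.lift_fst]; infer_instance
    exact mono_of_mono _ prod.fst
  have := mono_comp u (prod.lift (𝟙 X) g)
  -- `a` says `g x = y`, and `b` says `g x = y ∧ x ∈ U`. They agree for all `x` exactly when the
  -- fibre over `y` lies in `U`.
  let a : X ⨯ Y ⟶ K.Ω := K.χ (prod.lift (𝟙 X) g)
  let b : X ⨯ Y ⟶ K.Ω := K.χ (u ≫ prod.lift (𝟙 X) g)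
  obtain ⟨P, n, _, hn⟩ := exists_equalizer_family a b
  refine ⟨P, n, inferInstance, fun T t => ?_⟩
  rw [hn]
  have ha : ∀ ⦃Z : C⦄ (x : Z ⟶ X) (z : Z ⟶ T),
      Holds K (prod.lift x z ≫ prod.map (𝟙 X) t ≫ a) ↔ x ≫ g = z ≫ t := by
    intro Z x z
    rw [← Category.assoc, prod.lift_map, Category.comp_id, holds_χ_iff]
    constructor
    · rintro ⟨l, hl⟩
      have h1 := hl =≫ prod.fst
      have h2 := hl =≫ prod.snd
      rw [Category.assoc, prod.lift_fst, prod.lift_fst, Category.comp_id] at h1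
      rw [Category.assoc, prod.lift_snd, prod.lift_snd] at h2
      rw [← h1, h2]
    · intro h
      exact ⟨x, by rw [← h, prod.comp_lift, Category.comp_id]⟩
  have hb : ∀ ⦃Z : C⦄ (x : Z ⟶ X) (z : Z ⟶ T),
      Holds K (prod.lift x z ≫ prod.map (𝟙 X) t ≫ b) ↔
        x ≫ g = z ≫ t ∧ ∃ l, l ≫ u = x := by
    intro Z x z
    rw [← Category.assoc, prod.lift_map, Category.comp_id, holds_χ_iff]
    constructor
    · rintro ⟨l, hl⟩
      have h1 := hl =≫ prod.fst
      have h2 := hl =≫ prod.snd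
      rw [Category.assoc, Category.assoc, prod.lift_fst, prod.lift_fst, Category.comp_id] at h1
      rw [Category.assoc, Category.assoc, prod.lift_snd, prod.lift_snd] at h2
      exact ⟨by rw [← h1, ← h2, Category.assoc], l, h1⟩
    · rintro ⟨h, l, rfl⟩
      exact ⟨l, by rw [← h, ← Category.assoc, prod.comp_lift, Category.comp_id]⟩
  constructor
  · intro h Z z x hx
    have := (ha x z).2 hx
    rw [h] at this
    exact ((hb x z).1 this).2
  · intro h
    refine classifier_hom_ext K fun Z w => ?_
    obtain ⟨x, z, rfl⟩ : ∃ x z, w = prod.lift x z := ⟨w ≫ prod.fst, w ≫ prod.snd, by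
      apply Limits.prod.hom_ext
      · rw [prod.lift_fst]
      · rw [prod.lift_snd]⟩
    rw [ha, hb]
    exact ⟨fun hx => ⟨hx, h z x hx⟩, fun hx => hx.1⟩

/-- A family of morphisms to `Z` is covering if it is jointly extremal: every monomorphism through
which all its members factor is an isomorphism. -/
def Covers {Z : C} (R : Presieve Z) : Prop :=
  ∀ ⦃U : C⦄ (u : U ⟶ Z) [Mono u], (∀ ⦃T : C⦄ (t : T ⟶ Z), R t → ∃ l, l ≫ u = t) → IsIso u

theorem isIso_of_mono_of_section {U Z : C} (u : U ⟶ Z) [Mono u] (h : ∃ l, l ≫ u = 𝟙 Z) :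
    IsIso u := by
  obtain ⟨l, hl⟩ := h
  exact ⟨l, by rw [← cancel_mono u, Category.assoc, hl, Category.comp_id, Category.id_comp], hl⟩

theorem covers_of_id {Z : C} {R : Presieve Z} (h : R (𝟙 Z)) : Covers R :=
  fun _ u _ hu => isIso_of_mono_of_section u (hu _ h)

theorem Covers.mono {Z : C} {R S : Presieve Z} (h : Covers R)
    (hRS : ∀ ⦃T : C⦄ (t : T ⟶ Z), R t → S t) : Covers S :=
  fun _ u _ hu => h u fun _ t ht => hu t (hRS t ht)

/-- Covering families are jointly epimorphic. -/
theorem Covers.hom_ext [HasEqualizers C] {Z A : C} {R : Presieve Z} (h : Covers R) {f g : Z ⟶ A}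
    (hfg : ∀ ⦃T : C⦄ (t : T ⟶ Z), R t → t ≫ f = t ≫ g) : f = g := by
  have : IsIso (equalizer.ι f g) :=
    h _ fun T t ht => ⟨equalizer.lift t (hfg t ht), equalizer.lift_ι _ _⟩
  exact eq_of_epi_equalizer

/-- The union of the images of two morphisms, with its stable universal property. -/
theorem exists_union [IsElementaryTopos C] {A B X : C} (a : A ⟶ X) (b : B ⟶ X) :
    ∃ (S : C) (m : S ⟶ X) (_ : Mono m), (∃ l, l ≫ m = a) ∧ (∃ l, l ≫ m = b) ∧
      ∀ ⦃Z : C⦄ (s : Z ⟶ S),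
        Covers fun T (t : T ⟶ Z) => (∃ c, c ≫ a = t ≫ s ≫ m) ∨ (∃ c, c ≫ b = t ≫ s ≫ m) := by
  obtain ⟨⟨K⟩⟩ := IsElementaryTopos.hasSubobjectClassifier (C := C)
  -- Second-order disjunction: `x ∈ S` iff every ω implied both by `x ∈ im a` and by `x ∈ im b` is
  -- true. `Ha` and `Hb` consist of the pairs `(x, ω)` satisfying the respective implication, `h` is
  -- the inclusion of their intersection, and `V` is the part of it where ω holds.
  obtain ⟨Ua, ua, _, hua⟩ := exists_comprehension K (prod.snd : A ⨯ K.Ω ⟶ K.Ω)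
  obtain ⟨Ub, ub, _, hub⟩ := exists_comprehension K (prod.snd : B ⨯ K.Ω ⟶ K.Ω)
  obtain ⟨Ha, na₁, _, hna₁⟩ := exists_forall (prod.map a (𝟙 K.Ω)) ua
  obtain ⟨Hb, nb, _, hnb⟩ := exists_forall (prod.map b (𝟙 K.Ω)) ub
  obtain ⟨h, hh⟩ : ∃ h : pullback na₁ nb ⟶ X ⨯ K.Ω, h = pullback.fst na₁ nb ≫ na₁ := ⟨_, rfl⟩
  obtain ⟨V, w, _, hw⟩ := exists_comprehension K (h ≫ prod.snd)
  obtain ⟨S, m, _, hm⟩ := exists_forall (h ≫ prod.fst) w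
  have key : ∀ {A : C} (a : A ⟶ X) {Ua : C} (ua : Ua ⟶ A ⨯ K.Ω)
      (_ : ∀ ⦃T : C⦄ (t : T ⟶ A ⨯ K.Ω), (∃ l, l ≫ ua = t) ↔ Holds K (t ≫ prod.snd))
      {Ha : C} (na : Ha ⟶ X ⨯ K.Ω)
      (_ : ∀ ⦃T : C⦄ (t : T ⟶ X ⨯ K.Ω), (∃ l, l ≫ na = t) ↔
        ∀ ⦃Z : C⦄ (z : Z ⟶ T) (x : Z ⟶ A ⨯ K.Ω), x ≫ prod.map a (𝟙 K.Ω) = z ≫ t →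
          ∃ l, l ≫ ua = x) (p : pullback na₁ nb ⟶ Ha) (_ : p ≫ na = h), ∃ l, l ≫ m = a := by
    intro A a Ua ua hua Ha na hna p hp
    refine (hm a).2 fun Z z x hx => (hw x).2 ?_
    have h₁ := (hna (x ≫ h)).1 ⟨x ≫ p, by rw [Category.assoc, hp]⟩ (𝟙 Z)
      (prod.lift z (x ≫ h ≫ prod.snd)) (by
        rw [prod.lift_map, Category.id_comp, Category.comp_id, ← hx]
        apply Limits.prod.hom_ext
        · rw [prod.lift_fst, Category.assoc]
        · rw [prod.lift_snd, Category.assoc])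
    rwa [hua, prod.lift_snd] at h₁
  refine ⟨S, m, inferInstance, key a ua hua na₁ hna₁ (pullback.fst _ _) hh.symm,
    key b ub hub nb hnb (pullback.snd _ _) (pullback.condition.symm.trans hh.symm), fun Z s U u _ hu => ?_⟩
  -- The covering property is the definition of `S` instantiated at ω = `K.χ u`.
  have h₁ : ∃ l, l ≫ na₁ = prod.lift (s ≫ m) (K.χ u) := by
    refine (hna₁ _).2 fun Z' z x hx => (hua x).2 ?_
    have e₁ := hx =≫ prod.fst
    have e₂ := hx =≫ prod.snd
    simp only [prod.map_fst, prod.map_snd, Category.assoc, prod.lift_fst, prod.lift_snd,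
      Category.comp_id] at e₁ e₂
    rw [e₂, holds_χ_iff]
    exact hu z (Or.inl ⟨x ≫ prod.fst, by simpa using e₁⟩)
  have h₂ : ∃ l, l ≫ nb = prod.lift (s ≫ m) (K.χ u) := by
    refine (hnb _).2 fun Z' z x hx => (hub x).2 ?_
    have e₁ := hx =≫ prod.fst
    have e₂ := hx =≫ prod.snd
    simp only [prod.map_fst, prod.map_snd, Category.assoc, prod.lift_fst, prod.lift_snd,
      Category.comp_id] at e₁ e₂
    rw [e₂, holds_χ_iff]
    exact hu z (Or.inr ⟨x ≫ prod.fst, by simpa using e₁⟩)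
  obtain ⟨l₁, hl₁⟩ := h₁
  obtain ⟨l₂, hl₂⟩ := h₂
  let η : Z ⟶ pullback na₁ nb := pullback.lift l₁ l₂ (hl₁.trans hl₂.symm)
  have hη : η ≫ h = prod.lift (s ≫ m) (K.χ u) := by
    rw [← hl₁, hh, ← Category.assoc, pullback.lift_fst]
  have h₃ := (hm (s ≫ m)).1 ⟨s, rfl⟩ (𝟙 Z) η (by
    rw [← Category.assoc, hη, prod.lift_fst, Category.id_comp])
  rw [hw, ← Category.assoc, hη, prod.lift_snd, ← Category.id_comp (K.χ u), holds_χ_iff] at h₃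
  exact isIso_of_mono_of_section u h₃

/-- Factorization of a morphism through its image, with the stable universal property of the
image. -/
theorem exists_image [IsElementaryTopos C] {A X : C} (f : A ⟶ X) :
    ∃ (S : C) (e : A ⟶ S) (m : S ⟶ X) (_ : Mono m), e ≫ m = f ∧
      ∀ ⦃Z : C⦄ (s : Z ⟶ S), Covers fun T (t : T ⟶ Z) => ∃ c, c ≫ f = t ≫ s ≫ m := by
  obtain ⟨S, m, _, ⟨e, he⟩, _, h⟩ := exists_union f f
  exact ⟨S, e, m, inferInstance, he, fun Z s => (h s).mono fun T t ht => or_self_iff.1 ht⟩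

theorem epi_of_covers [HasEqualizers C] {X Y : C} (f : X ⟶ Y)
    (h : Covers fun T (t : T ⟶ Y) => ∃ c, c ≫ f = t) : Epi f where
  left_cancellation g g' hg := h.hom_ext fun T t ⟨c, hc⟩ => by
    rw [← hc, Category.assoc, Category.assoc, hg]

/-- In a topos, epimorphisms are stably covering. -/
theorem covers_of_epi [IsElementaryTopos C] {X Y Z : C} (f : X ⟶ Y) [Epi f] (y : Z ⟶ Y) :
    Covers fun T (t : T ⟶ Z) => ∃ c, c ≫ f = t ≫ y := by
  -- The classifier makes the category balanced, so the mono part of an epimorphism is invertible.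
  have := IsElementaryTopos.hasSubobjectClassifier (C := C)
  obtain ⟨S, e, m, _, he, h⟩ := exists_image f
  have : Epi m := epi_of_epi_fac he
  have : IsIso m := isIso_of_mono_of_epi m
  simpa using h (y ≫ inv m)

end InternalLogic

/-! ### The initial object, disjoint unions and `1 + 1`. -/

section Coproducts

variable {C : Type u} [Category.{v} C] [IsElementaryTopos C]

/-- A topos has an initial object `Z`, and every object with a morphism to `Z` has at most one
morphism to any other object. -/
theorem exists_strict_initial (C : Type u) [Category.{v} C] [IsElementaryTopos C] :
    ∃ (Z : C) (_ : IsInitial Z), ∀ ⦃T : C⦄, (T ⟶ Z) → ∀ ⦃A : C⦄ (f g : T ⟶ A), f = g := by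
  obtain ⟨⟨K⟩⟩ := IsElementaryTopos.hasSubobjectClassifier (C := C)
  -- `Z` is the truth value of "every proposition is true", so over `Z` every mono is invertible.
  -- Equalizers then give uniqueness of morphisms, and the mono `Z × A → Z` acquires a section,
  -- which gives existence.
  obtain ⟨Z, n, _, hn⟩ := exists_forall (terminal.from K.Ω) K.truth
  have huniq : ∀ ⦃T : C⦄, (T ⟶ Z) → ∀ ⦃A : C⦄ (f g : T ⟶ A), f = g := by
    intro T t A f g
    obtain ⟨l, hl⟩ := (hn (t ≫ n)).1 ⟨t, rfl⟩ (𝟙 T) (K.χ (equalizer.ι f g)) (Subsingleton.elim _ _)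
    have h : Holds K (𝟙 T ≫ K.χ (equalizer.ι f g)) := by
      rw [Category.id_comp, ← hl]
      exact holds_of_lift l
    have := isIso_of_mono_of_section _ ((holds_χ_iff K _ _).1 h)
    exact eq_of_epi_equalizer
  have hmap : ∀ A : C, Nonempty (Z ⟶ A) := fun A => by
    have : Mono (prod.fst : Z ⨯ A ⟶ Z) := ⟨fun f g _ => huniq (f ≫ prod.fst) f g⟩
    obtain ⟨l, hl⟩ := (hn n).1 ⟨𝟙 Z, Category.id_comp n⟩ (𝟙 Z)
      (K.χ (prod.fst : Z ⨯ A ⟶ Z)) (Subsingleton.elim _ _)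
    have h : Holds K (𝟙 Z ≫ K.χ (prod.fst : Z ⨯ A ⟶ Z)) := by
      rw [Category.id_comp, ← hl]
      exact holds_of_lift l
    obtain ⟨s, _⟩ := (holds_χ_iff K _ _).1 h
    exact ⟨s ≫ prod.snd⟩
  exact ⟨Z, IsInitial.ofUniqueHom (fun A => (hmap A).some) fun A f => huniq (𝟙 Z) _ _, huniq⟩

theorem prod_lift_eq {T X Y : C} (w : T ⟶ X ⨯ Y) : w = prod.lift (w ≫ prod.fst) (w ≫ prod.snd) := by
  apply Limits.prod.hom_ext
  · rw [prod.lift_fst]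
  · rw [prod.lift_snd]

/-- The subobject of those `(s, z)` such that `x c = z` whenever `i c = s`. -/
theorem exists_extension_graph {A S Z : C} (i : A ⟶ S) (x : A ⟶ Z) :
    ∃ (P : C) (n : P ⟶ S ⨯ Z) (_ : Mono n), ∀ ⦃T : C⦄ (s : T ⟶ S) (z : T ⟶ Z),
      (∃ l, l ≫ n = prod.lift s z) ↔
        ∀ ⦃T' : C⦄ (t : T' ⟶ T) (c : T' ⟶ A), c ≫ i = t ≫ s → c ≫ x = t ≫ z := by
  have hmono : Mono (prod.lift (𝟙 A) x) := by
    have : Mono (prod.lift (𝟙 A) x ≫ prod.fst) := by rw [prod.lift_fst]; infer_instance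
    exact mono_of_mono _ prod.fst
  -- Quantifies the graph of `x` along `i × 1`.
  obtain ⟨P, n, _, hn⟩ := exists_forall (prod.map i (𝟙 Z)) (prod.lift (𝟙 A) x)
  refine ⟨P, n, inferInstance, fun T s z => ?_⟩
  rw [hn]
  constructor
  · intro h T' t c hc
    obtain ⟨l, hl⟩ := h t (prod.lift c (t ≫ z)) (by
      rw [prod.lift_map, hc, prod.comp_lift, Category.comp_id])
    have h₁ := hl =≫ prod.fst
    have h₂ := hl =≫ prod.snd
    rw [Category.assoc, prod.lift_fst, prod.lift_fst, Category.comp_id] at h₁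
    rw [Category.assoc, prod.lift_snd, prod.lift_snd] at h₂
    rw [← h₁, h₂]
  · intro h T' t w hw
    have h₁ := hw =≫ prod.fst
    have h₂ := hw =≫ prod.snd
    rw [Category.assoc, Category.assoc, prod.map_fst, prod.lift_fst, ← Category.assoc] at h₁
    rw [Category.assoc, Category.assoc, prod.map_snd, prod.lift_snd, Category.comp_id] at h₂
    refine ⟨w ≫ prod.fst, ?_⟩
    rw [prod.comp_lift, Category.comp_id, h t (w ≫ prod.fst) h₁, ← h₂, ← prod_lift_eq]

/-- The union of two disjoint subobjects is their coproduct. -/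
theorem exists_disjoint_union {A B X : C} (a : A ⟶ X) (b : B ⟶ X) [Mono a] [Mono b]
    (disj : ∀ ⦃T : C⦄ (c : T ⟶ A) (d : T ⟶ B), c ≫ a = d ≫ b → ∀ ⦃Z : C⦄ (f g : T ⟶ Z), f = g) :
    ∃ (S : C) (i : A ⟶ S) (j : B ⟶ S) (m : S ⟶ X) (_ : Mono m), i ≫ m = a ∧ j ≫ m = b ∧
      Nonempty (IsColimit (BinaryCofan.mk i j)) := by
  obtain ⟨S, m, _, ⟨i, hi⟩, ⟨j, hj⟩, hcov⟩ := exists_union a b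
  have hcov' : ∀ ⦃Z : C⦄ (s : Z ⟶ S),
      Covers fun T (t : T ⟶ Z) => (∃ c, c ≫ i = t ≫ s) ∨ (∃ c, c ≫ j = t ≫ s) := by
    refine fun Z s => (hcov s).mono ?_
    rintro T t (⟨c, hc⟩ | ⟨c, hc⟩)
    · exact Or.inl ⟨c, by rw [← cancel_mono m, Category.assoc, hi, hc, Category.assoc]⟩
    · exact Or.inr ⟨c, by rw [← cancel_mono m, Category.assoc, hj, hc, Category.assoc]⟩
  have disj' : ∀ ⦃T : C⦄ (c : T ⟶ A) (d : T ⟶ B), c ≫ i = d ≫ j →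
      ∀ ⦃Z : C⦄ (f g : T ⟶ Z), f = g := fun T c d h => disj c d (by
    rw [← hi, ← hj, ← Category.assoc, h, Category.assoc])
  have : Mono i := by
    have : Mono (i ≫ m) := hi ▸ inferInstance
    exact mono_of_mono i m
  have : Mono j := by
    have : Mono (j ≫ m) := hj ▸ inferInstance
    exact mono_of_mono j m
  refine ⟨S, i, j, m, inferInstance, hi, hj, ?_⟩
  have hext : ∀ ⦃Z : C⦄ (f g : S ⟶ Z), i ≫ f = i ≫ g → j ≫ f = j ≫ g → f = g := by
    intro Z f g h₁ h₂
    refine (hcov' (𝟙 S)).hom_ext ?_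
    rintro T t (⟨c, hc⟩ | ⟨c, hc⟩)
    · rw [← Category.comp_id t, ← hc, Category.assoc, Category.assoc, h₁]
    · rw [← Category.comp_id t, ← hc, Category.assoc, Category.assoc, h₂]
  have hdesc : ∀ ⦃Z : C⦄ (x : A ⟶ Z) (y : B ⟶ Z), ∃ d : S ⟶ Z, i ≫ d = x ∧ j ≫ d = y := by
    intro Z x y
    -- The copairing is given by its graph: the pairs `(s, z)` compatible with both `x` and `y`. It
    -- remains to see that the projection of this graph to `S` is invertible.
    obtain ⟨P, n, _, hn⟩ := exists_extension_graph i x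
    obtain ⟨Q, k, _, hk⟩ := exists_extension_graph j y
    obtain ⟨g, hg⟩ : ∃ g : pullback n k ⟶ S ⨯ Z, g = pullback.fst n k ≫ n := ⟨_, rfl⟩
    have hg' : g = pullback.snd n k ≫ k := hg.trans pullback.condition
    have : Mono g := hg ▸ mono_comp _ _
    have hlift : ∀ ⦃T : C⦄ (s : T ⟶ S) (z : T ⟶ Z),
        (∀ ⦃T' : C⦄ (t : T' ⟶ T) (c : T' ⟶ A), c ≫ i = t ≫ s → c ≫ x = t ≫ z) →
        (∀ ⦃T' : C⦄ (t : T' ⟶ T) (c : T' ⟶ B), c ≫ j = t ≫ s → c ≫ y = t ≫ z) →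
        ∃ l, l ≫ g = prod.lift s z := by
      intro T s z h₁ h₂
      obtain ⟨l₁, hl₁⟩ := (hn s z).2 h₁
      obtain ⟨l₂, hl₂⟩ := (hk s z).2 h₂
      exact ⟨pullback.lift l₁ l₂ (hl₁.trans hl₂.symm), by
        rw [hg, ← Category.assoc, pullback.lift_fst, hl₁]⟩
    have hmem₁ : ∀ ⦃T T' : C⦄ (w : T ⟶ pullback n k) (t : T' ⟶ T) (c : T' ⟶ A),
        c ≫ i = t ≫ w ≫ g ≫ prod.fst → c ≫ x = t ≫ w ≫ g ≫ prod.snd := by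
      intro T T' w t c
      refine (hn (w ≫ g ≫ prod.fst) (w ≫ g ≫ prod.snd)).1 ⟨w ≫ pullback.fst n k, ?_⟩ t c
      rw [Category.assoc, ← hg, prod_lift_eq (w ≫ g), Category.assoc, Category.assoc]
    have hmem₂ : ∀ ⦃T T' : C⦄ (w : T ⟶ pullback n k) (t : T' ⟶ T) (c : T' ⟶ B),
        c ≫ j = t ≫ w ≫ g ≫ prod.fst → c ≫ y = t ≫ w ≫ g ≫ prod.snd := by
      intro T T' w t c
      refine (hk (w ≫ g ≫ prod.fst) (w ≫ g ≫ prod.snd)).1 ⟨w ≫ pullback.snd n k, ?_⟩ t c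
      rw [Category.assoc, ← hg', prod_lift_eq (w ≫ g), Category.assoc, Category.assoc]
    -- Single-valuedness is checked on the cover of `S` by `A` and `B`, where compatibility
    -- determines `z`.
    have : Mono (g ≫ prod.fst) := by
      constructor
      intro T w w' hw
      rw [← cancel_mono g]
      have hw' : w ≫ g ≫ prod.snd = w' ≫ g ≫ prod.snd := by
        refine (hcov' (w ≫ g ≫ prod.fst)).hom_ext ?_
        rintro T' t (⟨c, hc⟩ | ⟨c, hc⟩)
        · exact (hmem₁ w t c hc).symm.trans (hmem₁ w' t c (by rw [hc, hw]))
        · exact (hmem₂ w t c hc).symm.trans (hmem₂ w' t c (by rw [hc, hw]))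
      apply Limits.prod.hom_ext
      · rw [Category.assoc, Category.assoc, hw]
      · rw [Category.assoc, Category.assoc, hw']
    -- The graph contains `(i, x)` and `(j, y)`: each mixed condition lives on the overlap of `A`
    -- and `B`, where any two parallel morphisms agree.
    obtain ⟨li, hli⟩ := hlift i x
      (fun T' t c h => by rw [← cancel_mono i |>.1 h])
      (fun T' t c h => disj' t c h.symm _ _)
    obtain ⟨lj, hlj⟩ := hlift j y
      (fun T' t c h => disj' c t h _ _)
      (fun T' t c h => by rw [← cancel_mono j |>.1 h])
    have hli' : li ≫ g ≫ prod.fst = i := by rw [← Category.assoc, hli, prod.lift_fst]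
    have hlj' : lj ≫ g ≫ prod.fst = j := by rw [← Category.assoc, hlj, prod.lift_fst]
    have : IsIso (g ≫ prod.fst) := by
      refine hcov' (𝟙 S) _ ?_
      rintro T t (⟨c, hc⟩ | ⟨c, hc⟩)
      · exact ⟨c ≫ li, by rw [Category.assoc, hli', hc, Category.comp_id]⟩
      · exact ⟨c ≫ lj, by rw [Category.assoc, hlj', hc, Category.comp_id]⟩
    refine ⟨inv (g ≫ prod.fst) ≫ g ≫ prod.snd, ?_, ?_⟩
    · rw [← Category.assoc, ← (IsIso.eq_comp_inv _).2 hli', ← Category.assoc, hli, prod.lift_snd]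
    · rw [← Category.assoc, ← (IsIso.eq_comp_inv _).2 hlj', ← Category.assoc, hlj, prod.lift_snd]
  choose d hd₁ hd₂ using hdesc
  exact ⟨BinaryCofan.IsColimit.mk _ (fun x y => d x y) (fun x y => hd₁ x y) (fun x y => hd₂ x y)
    fun x y m h₁ h₂ => hext _ _ (h₁.trans (hd₁ x y).symm) (h₂.trans (hd₂ x y).symm)⟩

/-- The canonical morphism `1 + 1 ⟶ Ω` exists in a topos, and it is a monomorphism. -/
theorem exists_isBoolMap (K : Subobject.Classifier C) :
    ∃ (S : C) (b : S ⟶ K.Ω), Mono b ∧ IsBoolMap K b := by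
  obtain ⟨Z, hZ, huniq⟩ := exists_strict_initial C
  have : Mono (hZ.to K.Ω₀) := ⟨fun f g _ => huniq f f g⟩
  have hf : IsPullback (hZ.to K.Ω₀) (hZ.to K.Ω₀) (K.χ (hZ.to K.Ω₀)) K.truth := by
    have h := K.isPullback (hZ.to K.Ω₀)
    rwa [K.isTerminalΩ₀.hom_ext (K.χ₀ Z) (hZ.to K.Ω₀)] at h
  have : Mono (K.χ (hZ.to K.Ω₀)) := K.isTerminalΩ₀.mono_from _
  obtain ⟨S, i, j, m, _, hi, hj, hS⟩ := exists_disjoint_union K.truth (K.χ (hZ.to K.Ω₀))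
    -- Where true equals false there is a morphism to the initial object.
    fun T c d h => huniq (hf.lift d c h.symm)
  exact ⟨S, m, inferInstance, i, j, hS, hi, Z, hZ, hj ▸ hf⟩

end Coproducts

/-! ### The subterminal object β and the least logical class containing `b`. -/

section LogicalClassOfSubterminal

variable {C : Type u} [Category.{v} C]

/-- Membership in a subobject is local: the pullback of `m` along `y` is a mono through which a
covering family factors. -/
theorem exists_lift_of_covers [HasPullbacks C] {X Y Z : C} (m : X ⟶ Y) [Mono m] (y : Z ⟶ Y)
    (h : Covers fun T (t : T ⟶ Z) => ∃ x, x ≫ m = t ≫ y) : ∃ x, x ≫ m = y := by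
  have : IsIso (pullback.snd m y) :=
    h _ fun T t ⟨x, hx⟩ => ⟨pullback.lift x t hx, pullback.lift_snd _ _ _⟩
  exact ⟨inv (pullback.snd m y) ≫ pullback.fst m y, by
    rw [Category.assoc, pullback.condition, IsIso.inv_hom_id_assoc]⟩

theorem covers_of_lift {X Y Z : C} (f : X ⟶ Y) (y : Z ⟶ Y) (h : ∃ x, x ≫ f = y) :
    Covers fun T (t : T ⟶ Z) => ∃ x, x ≫ f = t ≫ y := by
  obtain ⟨x, hx⟩ := h
  exact covers_of_id ⟨x, by rw [hx, Category.id_comp]⟩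

/-- The morphisms that become epimorphisms in the open subtopos determined by `β`. -/
def coveringAbove (β : C) : MorphismProperty C := fun _ Y f =>
  ∀ ⦃Z : C⦄, (Z ⟶ β) → ∀ y : Z ⟶ Y, Covers fun T (t : T ⟶ Z) => ∃ x, x ≫ f = t ≫ y

/-- A mono that is covering over β admits lifts of all elements defined over β. For closure under ∀,
regard `β × Q` as a subobject of `Y`: its pullback to `X` lies in `V`, hence in `U` because it is
over β. By adjunction `β × Q ≤ P`, so elements of `Q` over β lift along `m'`. -/
theorem isLogicalClass_coveringAbove [IsElementaryTopos C] (β : C)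
    (hβ : ∀ ⦃T : C⦄ (f g : T ⟶ β), f = g) : IsLogicalClass (coveringAbove β) where
  comp_mem f g hf hg Z c y U u _ hu := by
    refine hg c y u ?_
    rintro T t ⟨y₁, hy₁⟩
    -- The domain of `t` lies over β too, so covering by `f` shows that `t` itself factors through
    -- `u`.
    have : IsIso (pullback.snd u t) := by
      refine hf (t ≫ c) y₁ _ ?_
      rintro T' t' ⟨x, hx⟩
      obtain ⟨l, hl⟩ := hu (t' ≫ t) ⟨x, by
        rw [← Category.assoc, hx, Category.assoc, hy₁, Category.assoc]⟩
      exact ⟨pullback.lift l t' hl, pullback.lift_snd _ _ _⟩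
    exact ⟨inv (pullback.snd u t) ≫ pullback.fst u t, by
      rw [Category.assoc, pullback.condition, IsIso.inv_hom_id_assoc]⟩
  of_isPullback {X Y Y' S f g f' g'} sq hg Z c y := by
    refine (hg c (y ≫ f)).mono ?_
    rintro T t ⟨x, hx⟩
    exact ⟨sq.lift x (t ≫ y) (by rw [hx, Category.assoc]), sq.lift_snd _ _ _⟩
  iso_mem f _ Z c y := covers_of_lift f y ⟨y ≫ inv f, by simp⟩
  epi_mem f _ Z c y := covers_of_epi f y
  mono_part_mem e m _ _ h Z c y := by
    refine (h c y).mono ?_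
    rintro T t ⟨x, hx⟩
    exact ⟨x ≫ e, by rw [← hx, Category.assoc]⟩
  forall_mem {U V X Y P Q} m f g _ _ n k _ _ m' hn hk hm' hm Z c y := by
    have : Mono (prod.snd : β ⨯ Q ⟶ Q) :=
      ⟨fun w w' h => Limits.prod.hom_ext (hβ _ _) h⟩
    have h₁ : (Subobject.pullback g).obj (Subobject.mk ((prod.snd : β ⨯ Q ⟶ Q) ≫ k)) ≤
        Subobject.mk f := (hk _).1 (Subobject.mk_le_mk_of_comm prod.snd rfl)
    have h₂ : Subobject.mk ((prod.snd : β ⨯ Q ⟶ Q) ≫ k) ≤ Subobject.mk n := by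
      refine (hn _).2 ?_
      obtain ⟨l', hl'⟩ := exists_lift_of_covers m (Subobject.ofLEMk _ f h₁)
        (hm (Subobject.pullbackπ g _ ≫ (Subobject.underlyingIso _).hom ≫ prod.fst) _)
      exact Subobject.le_mk_of_comm l' (by
        rw [← Category.assoc, hl', Subobject.ofLEMk_comp])
    refine covers_of_lift m' y ⟨prod.lift c y ≫ Subobject.ofMkLEMk _ _ h₂, ?_⟩
    rw [← cancel_mono k, Category.assoc, Category.assoc, hm', Subobject.ofMkLEMk_comp,
      ← Category.assoc, prod.lift_snd]

/-- Links the elementwise quantifier to the adjoint of `Subobject.pullback`: the former is tested on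
the arrow of `R`. -/
theorem isForall_of_forall [HasPullbacks C] {U X Y P : C} (g : X ⟶ Y) (u : U ⟶ X) [Mono u]
    (n : P ⟶ Y) [Mono n]
    (h : ∀ ⦃T : C⦄ (t : T ⟶ Y), (∃ l, l ≫ n = t) ↔
      ∀ ⦃Z : C⦄ (z : Z ⟶ T) (x : Z ⟶ X), x ≫ g = z ≫ t → ∃ l, l ≫ u = x) :
    IsForall g u n := by
  intro R
  constructor
  · intro hR
    obtain ⟨l, hl⟩ := (h R.arrow).1 ⟨Subobject.ofLEMk R n hR, Subobject.ofLEMk_comp _⟩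
      (Subobject.pullbackπ g R) ((Subobject.pullback g).obj R).arrow
      (Subobject.isPullback g R).w.symm
    exact Subobject.le_mk_of_comm l hl
  · intro hR
    obtain ⟨l, hl⟩ := (h R.arrow).2 fun Z z x hx =>
      ⟨(Subobject.isPullback g R).lift z x hx.symm ≫ Subobject.ofLEMk _ u hR, by
        rw [Category.assoc, Subobject.ofLEMk_comp, (Subobject.isPullback g R).lift_snd]⟩
    exact Subobject.le_mk_of_comm l hl

/-- Both classify the same subobject `0 → 1`, as any two initial objects are isomorphic; it is mono
as a pullback of truth. -/
theorem IsFalsity.ext {K : Subobject.Classifier C} {f g : K.Ω₀ ⟶ K.Ω} (hf : IsFalsity K f)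
    (hg : IsFalsity K g) : f = g := by
  obtain ⟨Z, hZ, h⟩ := hf
  obtain ⟨Z', hZ', h'⟩ := hg
  have : Mono (hZ.to K.Ω₀) := by
    rw [show hZ.to K.Ω₀ = hZ.to Z' ≫ hZ'.to K.Ω₀ from hZ.hom_ext _ _]
    have : IsIso (hZ.to Z') := ⟨hZ'.to Z, hZ.hom_ext _ _, hZ'.hom_ext _ _⟩
    have : Mono (hZ'.to K.Ω₀) := 
      MorphismProperty.of_isPullback (P := MorphismProperty.monomorphisms C) h'.flip K.mono_truth
    exact mono_comp _ _
  have h₂ : IsPullback (hZ.to K.Ω₀) (hZ.to K.Ω₀) g K.truth :=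
    h'.of_iso (hZ'.uniqueUpToIso hZ) (Iso.refl _) (Iso.refl _) (Iso.refl _)
      (hZ'.hom_ext _ _) (hZ'.hom_ext _ _) (by simp) (by simp)
  exact (K.uniq _ h).trans (K.uniq _ h₂).symm

theorem exists_desc {A B S : C} {i : A ⟶ S} {j : B ⟶ S} (h : IsColimit (BinaryCofan.mk i j))
    {Z : C} (x : A ⟶ Z) (y : B ⟶ Z) : ∃ d : S ⟶ Z, i ≫ d = x ∧ j ≫ d = y :=
  ⟨_, (BinaryCofan.IsColimit.desc' h x y).2⟩

theorem coproduct_hom_ext {A B S : C} {i : A ⟶ S} {j : B ⟶ S}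
    (h : IsColimit (BinaryCofan.mk i j)) {Z : C} {f g : S ⟶ Z} (h₁ : i ≫ f = i ≫ g)
    (h₂ : j ≫ f = j ≫ g) : f = g :=
  BinaryCofan.IsColimit.hom_ext h h₁ h₂

/-- The morphism `1 + 1 ⟶ Ω` is unique up to isomorphism. -/
theorem IsBoolMap.exists_hom {K K' : Subobject.Classifier C} {S S' : C} {b : S ⟶ K.Ω}
    {b' : S' ⟶ K'.Ω} (h : IsBoolMap K b) (h' : IsBoolMap K' b') :
    ∃ d : S ⟶ S', d ≫ b' ≫ K'.hom K = b := by
  obtain ⟨i, j, ⟨hS⟩, hi, hj⟩ := h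
  obtain ⟨i', j', ⟨hS'⟩, hi', hj'⟩ := h'
  obtain ⟨d, hd₁, hd₂⟩ := exists_desc hS (K'.χ₀ K.Ω₀ ≫ i') (K'.χ₀ K.Ω₀ ≫ j')
  refine ⟨d, coproduct_hom_ext hS ?_ ?_⟩
  · rw [← Category.assoc, hd₁, Category.assoc, ← Category.assoc i', hi', hi,
      Subobject.Classifier.truth_comp_hom, ← Category.assoc]
    exact (congrArg (· ≫ K.truth) (K.isTerminalΩ₀.hom_ext _ (𝟙 _))).trans (Category.id_comp _)
  · rw [← Category.assoc, hd₂]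
    refine IsFalsity.ext ?_ hj
    obtain ⟨Z, hZ, sq⟩ := hj'
    refine ⟨Z, hZ, ?_⟩
    -- `K'.hom K` classifies the truth of `K'`, so pasting turns falsity for `K'` into falsity for
    -- `K`.
    have sq₁ := sq.paste_vert (K.isPullback K'.truth)
    refine sq₁.of_iso (Iso.refl Z) (K'.isTerminalΩ₀.uniqueUpToIso K.isTerminalΩ₀) (Iso.refl _)
      (Iso.refl _) (hZ.hom_ext _ _) (hZ.hom_ext _ _) ?_ (by simp)
    rw [Iso.refl_hom, Category.comp_id, ← Category.assoc, ← Category.assoc, ← Category.assoc]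
    exact congrArg (· ≫ K'.hom K) (congrArg (· ≫ b') ((Category.id_comp _).symm.trans
      (congrArg (· ≫ j') (K'.isTerminalΩ₀.hom_ext _ _))))

/-- The truth value "every proposition is decidable" determines the least logical class
containing `1 + 1 ⟶ Ω`. -/
theorem exists_decidability (C : Type u) [Category.{v} C] [IsElementaryTopos C]
    (K : Subobject.Classifier C) :
    ∃ (β S : C) (b : S ⟶ K.Ω), (∀ ⦃T : C⦄ (f g : T ⟶ β), f = g) ∧
      boolClass C (terminal.from β) ∧ boolClass C ≤ coveringAbove β ∧ Mono b ∧ IsBoolMap K b ∧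
      ∀ ⦃T : C⦄, (T ⟶ β) → ∀ p : T ⟶ K.Ω, ∃ s, s ≫ b = p := by
  obtain ⟨S, b, _, hb⟩ := exists_isBoolMap K
  obtain ⟨β, n, _, hn⟩ := exists_forall (terminal.from K.Ω) b
  have hsub : ∀ ⦃T : C⦄ (f g : T ⟶ β), f = g := fun T f g => by
    rw [← cancel_mono n]
    exact Subsingleton.elim _ _
  have hdec : ∀ ⦃T : C⦄, (T ⟶ β) → ∀ p : T ⟶ K.Ω, ∃ s, s ≫ b = p := fun T c p =>
    (hn (c ≫ n)).1 ⟨c, rfl⟩ (𝟙 T) p (Subsingleton.elim _ _)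
  refine ⟨β, S, b, hsub, ?_, ?_, inferInstance, hb, hdec⟩
  · rw [Subsingleton.elim (terminal.from β) n]
    -- `β → 1` is the inclusion of `∀ b` into `∀ 1_Ω = 1`.
    refine IsLogicalClass.forall_mem b (𝟙 K.Ω) (terminal.from K.Ω) n (𝟙 (⊤_ C)) n ?_ ?_
      (Category.comp_id n) (containsBoolMap_boolClass K S b hb)
    · refine isForall_of_forall _ _ _ fun T t => ?_
      rw [hn]
      simp only [Category.comp_id]
    · exact isForall_of_forall _ _ _ fun T t =>
        ⟨fun _ Z z x _ => ⟨x, Category.comp_id x⟩, fun _ => ⟨t, Category.comp_id t⟩⟩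
  · have := isLogicalClass_coveringAbove β hsub
    refine boolClass_le _ fun K' S' b' hb' Z c y => ?_
    obtain ⟨d, hd⟩ := hb.exists_hom hb'
    obtain ⟨s, hs⟩ := hdec c (y ≫ K'.hom K)
    refine covers_of_lift b' y ⟨s ≫ d, ?_⟩
    rw [← cancel_mono (K'.hom K), ← hs, ← hd]
    simp only [Category.assoc]

end LogicalClassOfSubterminal

/-! ### Transfer of topos structure along equivalences and coreflections. -/

section Transfer

universe v₁ v₂ u₁ u₂

variable {C : Type u₁} [Category.{v₁} C] {D : Type u₂} [Category.{v₂} D]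

/-- Exponentiability is inherited by coreflective full subcategories closed under binary
products. -/
theorem exponentiable_of_fullyFaithful [HasBinaryProducts C] [HasBinaryProducts D] (J : D ⥤ C)
    [J.Full] [J.Faithful] [J.IsLeftAdjoint] [PreservesLimitsOfShape (Discrete WalkingPair) J]
    (A : D) [(prod.functor.obj (J.obj A)).IsLeftAdjoint] :
    (prod.functor.obj A).IsLeftAdjoint := by
  -- The exponential in `D` is the coreflection of the one formed in `C`, since `J (A × B) ≅ J A × J
  -- B`.
  let adj := (Adjunction.ofIsLeftAdjoint J).comp
    (Adjunction.ofIsLeftAdjoint (prod.functor.obj (J.obj A)))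
  exact (adj.restrictFullyFaithful (iC := 𝟭 D) (iD := J) (L := prod.functor.obj A)
    (R := J ⋙ _) (Functor.FullyFaithful.id D) (Functor.FullyFaithful.ofFullyFaithful J)
    (Functor.leftUnitor _ ≪≫ (prodComparisonNatIso J A).symm)
    (Functor.rightUnitor _).symm).isLeftAdjoint

theorem isElementaryTopos_of_equivalence (e : C ≌ D) [IsElementaryTopos C] :
    IsElementaryTopos D := by
  have hfin : HasFiniteLimits D := ⟨fun J _ _ =>
    Adjunction.hasLimitsOfShape_of_equivalence e.inverse⟩
  refine ⟨hfin, fun A => ?_, ?_⟩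
  · have := IsElementaryTopos.exponentiable (e.inverse.obj A)
    exact exponentiable_of_fullyFaithful e.inverse A
  · obtain ⟨⟨K⟩⟩ := IsElementaryTopos.hasSubobjectClassifier (C := C)
    exact ⟨⟨K.ofEquivalence e⟩⟩

theorem isBooleanTopos_of_equivalence (e : C ≌ D) [IsBooleanTopos C] : IsBooleanTopos D := by
  have := isElementaryTopos_of_equivalence e
  obtain ⟨K, S, b, ⟨i, j, ⟨hS⟩, hi, Z, hZ, sq⟩, hb⟩ := IsBooleanTopos.boolean (C := C)
  refine ⟨K.ofEquivalence e, e.functor.obj S, e.functor.map b,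
    ⟨e.functor.map i, e.functor.map j,
      ⟨mapIsColimitOfPreservesOfIsColimit e.functor i j hS⟩, ?_, e.functor.obj Z,
      hZ.isInitialObj e.functor, ?_⟩, e.functor.map_isIso b⟩
  · exact (e.functor.map_comp _ _).symm.trans (congrArg e.functor.map hi)
  · have h := sq.map e.functor
    rw [e.functor.map_comp] at h
    exact h.of_iso (Iso.refl _) (Iso.refl _) (Iso.refl _) (Iso.refl _)
      ((hZ.isInitialObj e.functor).hom_ext _ _) ((hZ.isInitialObj e.functor).hom_ext _ _)
      ((Category.comp_id _).trans (Category.id_comp _).symm)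
      ((Category.comp_id _).trans (Category.id_comp _).symm)

end Transfer

/-! ### The open subtopos over β and its Booleanness. -/

section OpenSubtopos

variable {C : Type u} [Category.{v} C]

/-- The objects lying over the subterminal object `β`. -/
def below (β : C) : ObjectProperty C := fun A => Nonempty (A ⟶ β)

instance (β : C) (J : Type*) [Category* J] [hJ : Nonempty J] :
    (below β).IsClosedUnderLimitsOfShape J where
  limitsOfShape_le := by
    rintro X ⟨h⟩
    exact (h.prop_diag_obj hJ.some).map fun f => h.π.app hJ.some ≫ f

/-- Limits of nonempty shape are inherited; only the terminal object changes, to β. -/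
theorem hasFiniteLimits_below [HasFiniteLimits C] (β : C) (hβ : ∀ ⦃T : C⦄ (f g : T ⟶ β), f = g) :
    HasFiniteLimits (below β).FullSubcategory := by
  have : HasTerminal (below β).FullSubcategory :=
    (IsTerminal.ofUniqueHom (Y := ⟨β, ⟨𝟙 β⟩⟩) (fun A => ObjectProperty.homMk A.property.some)
      fun A f => ObjectProperty.hom_ext _ (hβ _ _)).hasTerminal
  exact hasFiniteLimits_of_hasTerminal_and_pullbacks

/-- The coreflection is `B ↦ β × B`; it supplies the exponentials of the subtopos. -/
theorem isLeftAdjoint_below_ι [HasFiniteLimits C] (β : C)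
    (hβ : ∀ ⦃T : C⦄ (f g : T ⟶ β), f = g) : (below β).ι.IsLeftAdjoint :=
  (Adjunction.adjunctionOfEquivRight (F := (below β).ι)
    (G_obj := fun B => ⟨β ⨯ B, ⟨prod.fst⟩⟩)
    (fun A B =>
      { toFun := fun f => ObjectProperty.homMk (prod.lift A.property.some f)
        invFun := fun f => f.hom ≫ prod.snd
        left_inv := fun f => prod.lift_snd _ _
        right_inv := fun f => ObjectProperty.hom_ext _
          (Limits.prod.hom_ext (hβ _ _) (prod.lift_snd _ _)) })
    (fun A' A B f g => ObjectProperty.hom_ext _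
      (Limits.prod.hom_ext (hβ _ _)
        ((prod.lift_snd _ _).trans (by simp [prod.lift_snd]))))).isLeftAdjoint

/-- The map "true" of the open subtopos determined by `β`. -/
noncomputable abbrev truthBelow [HasFiniteLimits C] (β : C) (K : Subobject.Classifier C) :
    β ⟶ β ⨯ K.Ω :=
  prod.lift (𝟙 β) (K.χ₀ β ≫ K.truth)

/-- As β is subterminal, a morphism to `β × Ω` is determined by its second component. This gives
both existence and uniqueness of characteristic maps in the subtopos. -/
theorem isPullback_truthBelow_iff [HasFiniteLimits C] (β : C) (K : Subobject.Classifier C)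
    (hβ : ∀ ⦃T : C⦄ (f g : T ⟶ β), f = g) {U X : C} (u : U ⟶ X) [Mono u] (c : U ⟶ β)
    (χ : X ⟶ β ⨯ K.Ω) :
    IsPullback u c χ (truthBelow β K) ↔ χ ≫ prod.snd = K.χ u := by
  have hsnd : ∀ {T : C} (t : T ⟶ β), Holds K (t ≫ truthBelow β K ≫ prod.snd) := fun t => by
    rw [prod.lift_snd, ← Category.assoc]
    exact holds_of_lift _
  have hext : ∀ {T : C} (s : T ⟶ X) (t : T ⟶ β), Holds K (s ≫ χ ≫ prod.snd) →
      s ≫ χ = t ≫ truthBelow β K := fun s t h => by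
    refine Limits.prod.hom_ext (hβ _ _) ?_
    rw [Category.assoc, Category.assoc, h]
    exact (hsnd t).symm
  constructor
  · intro sq
    refine classifier_hom_ext K fun T t => ?_
    rw [holds_χ_iff]
    constructor
    · intro h
      exact ⟨sq.lift t (t ≫ χ ≫ prod.fst) (hext _ _ h), sq.lift_fst _ _ _⟩
    · rintro ⟨l, rfl⟩
      rw [Category.assoc, sq.w_assoc]
      simpa only [Category.assoc] using hsnd (l ≫ c)
  · intro h
    have hlift : ∀ {T : C} (s : T ⟶ X) (t : T ⟶ β), s ≫ χ = t ≫ truthBelow β K →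
        ∃ l, l ≫ u = s := fun s t hst => by
      rw [← holds_χ_iff K, ← h, ← Category.assoc, hst, Category.assoc]
      exact hsnd t
    refine ⟨⟨hext u c (h ▸ (holds_χ_iff K u u).2 ⟨𝟙 U, Category.id_comp u⟩)⟩,
      ⟨PullbackCone.IsLimit.mk _ (fun s => (hlift s.fst s.snd s.condition).choose)
        (fun s => (hlift s.fst s.snd s.condition).choose_spec) (fun s => hβ _ _) ?_⟩⟩
    intro s m hm _
    rw [← cancel_mono u, hm, (hlift s.fst s.snd s.condition).choose_spec]

/-- The subobject classifier of the open subtopos determined by `β`. -/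
noncomputable def classifierBelow [HasFiniteLimits C] (β : C) (K : Subobject.Classifier C)
    (hβ : ∀ ⦃T : C⦄ (f g : T ⟶ β), f = g) :
    Subobject.Classifier (below β).FullSubcategory :=
  Subobject.Classifier.mkOfTerminalΩ₀ ⟨β, ⟨𝟙 β⟩⟩
    (IsTerminal.ofUniqueHom (fun A => ObjectProperty.homMk A.property.some)
      fun _ _ => ObjectProperty.hom_ext _ (hβ _ _))
    ⟨β ⨯ K.Ω, ⟨prod.fst⟩⟩ (ObjectProperty.homMk (truthBelow β K))
    (fun {_ X} m _ => ObjectProperty.homMk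
      (prod.lift X.property.some (K.χ ((below β).ι.map m))))
    (fun m _ => IsPullback.of_map (below β).ι
      (ObjectProperty.hom_ext _ (((isPullback_truthBelow_iff β K hβ ((below β).ι.map m) _ _).2
        (prod.lift_snd _ _)).w))
      ((isPullback_truthBelow_iff β K hβ ((below β).ι.map m) _ _).2 (prod.lift_snd _ _)))
    (fun m _ _ sq => ObjectProperty.hom_ext _ (Limits.prod.hom_ext (hβ _ _)
      (((isPullback_truthBelow_iff β K hβ ((below β).ι.map m) _ _).1
        (sq.map (below β).ι)).trans (prod.lift_snd _ _).symm)))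

theorem isElementaryTopos_below [IsElementaryTopos C] (β : C)
    (hβ : ∀ ⦃T : C⦄ (f g : T ⟶ β), f = g) : IsElementaryTopos (below β).FullSubcategory := by
  have hfin := hasFiniteLimits_below β hβ
  refine ⟨hfin, fun A => ?_, ?_⟩
  · have := isLeftAdjoint_below_ι β hβ
    have := IsElementaryTopos.exponentiable ((below β).ι.obj A)
    exact exponentiable_of_fullyFaithful (below β).ι A
  · obtain ⟨⟨K⟩⟩ := IsElementaryTopos.hasSubobjectClassifier (C := C)
    exact ⟨⟨classifierBelow β K hβ⟩⟩

/-- If every proposition is decidable over `β`, then the open subtopos determined by `β` is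
Boolean. -/
theorem isBooleanTopos_below [IsElementaryTopos C] (β : C)
    (hβ : ∀ ⦃T : C⦄ (f g : T ⟶ β), f = g) (K : Subobject.Classifier C) {S : C} (b : S ⟶ K.Ω)
    [Mono b] (hb : IsBoolMap K b) (hdec : ∀ ⦃T : C⦄, (T ⟶ β) → ∀ p : T ⟶ K.Ω, ∃ s, s ≫ b = p) :
    IsBooleanTopos (below β).FullSubcategory := by
  have := isElementaryTopos_below β hβ
  obtain ⟨i, j, ⟨hS⟩, hi, Z, hZ, sq⟩ := hb
  have hexp := IsElementaryTopos.exponentiable β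
  -- `β × -` is a left adjoint, so `β × S` is a coproduct of two copies of `β × 1 ≅ β`, the terminal
  -- object of the subtopos.
  have hS' : IsColimit (BinaryCofan.mk (prod.map (𝟙 β) i) (prod.map (𝟙 β) j)) :=
    mapIsColimitOfPreservesOfIsColimit (prod.functor.obj β) i j hS
  have hlift : ∀ (k : K.Ω₀ ⟶ S), prod.lift (𝟙 β) (K.χ₀ β) ≫ prod.map (𝟙 β) k =
      prod.lift (𝟙 β) (K.χ₀ β ≫ k) := fun k => by rw [prod.lift_map, Category.id_comp]
  have hfst : (prod.fst : β ⨯ K.Ω₀ ⟶ β) ≫ prod.lift (𝟙 β) (K.χ₀ β) = 𝟙 _ :=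
    Limits.prod.hom_ext (hβ _ _) (K.isTerminalΩ₀.hom_ext _ _)
  have hfst' : ∀ (k : K.Ω₀ ⟶ S), prod.map (𝟙 β) k =
      prod.fst ≫ prod.lift (𝟙 β) (K.χ₀ β ≫ k) := fun k => by
    rw [← hlift, ← Category.assoc, hfst, Category.id_comp]
  let S' : (below β).FullSubcategory := ⟨β ⨯ S, ⟨prod.fst⟩⟩
  let b' : S' ⟶ (classifierBelow β K hβ).Ω := ObjectProperty.homMk (prod.map (𝟙 β) b)
  let i' : (classifierBelow β K hβ).Ω₀ ⟶ S' :=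
    ObjectProperty.homMk (prod.lift (𝟙 β) (K.χ₀ β ≫ i))
  let j' : (classifierBelow β K hβ).Ω₀ ⟶ S' :=
    ObjectProperty.homMk (prod.lift (𝟙 β) (K.χ₀ β ≫ j))
  have hdesc : ∀ {A : C} (x y : β ⟶ A), ∃ d : β ⨯ S ⟶ A,
      prod.lift (𝟙 β) (K.χ₀ β ≫ i) ≫ d = x ∧ prod.lift (𝟙 β) (K.χ₀ β ≫ j) ≫ d = y := by
    intro A x y
    obtain ⟨d, h₁, h₂⟩ := exists_desc hS' (prod.fst ≫ x) (prod.fst ≫ y)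
    refine ⟨d, ?_, ?_⟩
    · rw [← hlift, Category.assoc, h₁, ← Category.assoc, prod.lift_fst, Category.id_comp]
    · rw [← hlift, Category.assoc, h₂, ← Category.assoc, prod.lift_fst, Category.id_comp]
  have hext : ∀ {A : C} (d d' : β ⨯ S ⟶ A),
      prod.lift (𝟙 β) (K.χ₀ β ≫ i) ≫ d = prod.lift (𝟙 β) (K.χ₀ β ≫ i) ≫ d' →
      prod.lift (𝟙 β) (K.χ₀ β ≫ j) ≫ d = prod.lift (𝟙 β) (K.χ₀ β ≫ j) ≫ d' → d = d' := by
    intro A d d' h₁ h₂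
    refine coproduct_hom_ext hS' ?_ ?_
    · rw [hfst', Category.assoc, h₁, Category.assoc]
    · rw [hfst', Category.assoc, h₂, Category.assoc]
  let Z' : (below β).FullSubcategory := ⟨Z, ⟨hZ.to β⟩⟩
  have hZ' : IsInitial Z' := IsInitial.ofUniqueHom (fun A => ObjectProperty.homMk (hZ.to A.obj))
    fun A f => ObjectProperty.hom_ext _ (hZ.hom_ext _ _)
  have hjb : prod.lift (𝟙 β) (K.χ₀ β ≫ j) ≫ prod.map (𝟙 β) b =
      prod.lift (𝟙 β) (K.χ₀ β ≫ j ≫ b) := by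
    rw [prod.lift_map, Category.id_comp, Category.assoc]
  refine ⟨classifierBelow β K hβ, S', b', ⟨i', j', ⟨BinaryCofan.IsColimit.mk _
    (fun {A} x y => ObjectProperty.homMk (hdesc x.hom y.hom).choose)
    (fun {A} x y => ObjectProperty.hom_ext _ (hdesc x.hom y.hom).choose_spec.1)
    (fun {A} x y => ObjectProperty.hom_ext _ (hdesc x.hom y.hom).choose_spec.2)
    (fun {A} x y m h₁ h₂ => ObjectProperty.hom_ext _ (hext _ _
      ((congrArg (·.hom) h₁).trans (hdesc x.hom y.hom).choose_spec.1.symm)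
      ((congrArg (·.hom) h₂).trans (hdesc x.hom y.hom).choose_spec.2.symm)))⟩, ?_, Z', hZ', ?_⟩, ?_⟩
  · refine ObjectProperty.hom_ext _ ?_
    change prod.lift (𝟙 β) (K.χ₀ β ≫ i) ≫ prod.map (𝟙 β) b = truthBelow β K
    rw [prod.lift_map, Category.id_comp, Category.assoc, hi]
  · have : Mono (hZ.to β) := ⟨fun f g _ => sq.hom_ext (K.isTerminalΩ₀.hom_ext _ _)
      (K.isTerminalΩ₀.hom_ext _ _)⟩
    have h : IsPullback (hZ.to β) (hZ.to β)
        (prod.lift (𝟙 β) (K.χ₀ β ≫ j) ≫ prod.map (𝟙 β) b) (truthBelow β K) := by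
      rw [isPullback_truthBelow_iff β K hβ, hjb, prod.lift_snd]
      refine classifier_hom_ext K fun T t => ?_
      rw [holds_χ_iff]
      constructor
      · intro h
        exact ⟨sq.lift (t ≫ K.χ₀ β) (K.χ₀ T) (by rw [Category.assoc]; exact h), hβ _ _⟩
      · rintro ⟨l, rfl⟩
        have e : (l ≫ hZ.to β) ≫ K.χ₀ β ≫ j ≫ b = (l ≫ hZ.to K.Ω₀) ≫ K.truth := by
          rw [Category.assoc, Category.assoc, ← sq.w, ← Category.assoc (hZ.to β)]
          congr 2
          exact K.isTerminalΩ₀.hom_ext _ _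
        rw [e]
        exact holds_of_lift _
    have e₁ : (hZ'.to (classifierBelow β K hβ).Ω₀).hom = hZ.to β := hZ.hom_ext _ _
    refine IsPullback.of_map (below β).ι (hZ'.hom_ext _ _) ?_
    change IsPullback (hZ'.to (classifierBelow β K hβ).Ω₀).hom
      (hZ'.to (classifierBelow β K hβ).Ω₀).hom
      (prod.lift (𝟙 β) (K.χ₀ β ≫ j) ≫ prod.map (𝟙 β) b) (truthBelow β K)
    rw [e₁]
    exact h
  -- Decidability of the generic proposition over β yields the inverse of `β × b`.
  · obtain ⟨s, hs⟩ := hdec (prod.fst : β ⨯ K.Ω ⟶ β) prod.snd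
    have : IsIso (prod.map (𝟙 β) b) := by
      refine ⟨prod.lift prod.fst s, ?_, ?_⟩
      · refine Limits.prod.hom_ext (hβ _ _) ?_
        rw [← cancel_mono b, Category.id_comp, ← prod.map_snd (𝟙 β) b, Category.assoc,
          Category.assoc, ← Category.assoc (prod.lift _ _), prod.lift_snd, hs]
      · refine Limits.prod.hom_ext (hβ _ _) ?_
        rw [Category.assoc, prod.map_snd, ← Category.assoc, prod.lift_snd, hs, Category.id_comp]
    exact (ObjectProperty.isIso_hom_iff b').1 this

end OpenSubtopos

/-! ### Graphs as an equivalence from the open subtopos to the category of maps. -/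

namespace SpanCat

section Graphs

variable {C : Type u} [Category.{v} C] [HasFiniteLimits C] (W : MorphismProperty C)
  [hW : IsLogicalClass W]

/-- The graph of a morphism. -/
def graph {A B : C} (f : A ⟶ B) : (⟨A⟩ : SpanCat W) ⟶ ⟨B⟩ :=
  cls W (Sp.mk (𝟙 A) f)

theorem graph_id (A : C) : graph W (𝟙 A) = 𝟙 (⟨A⟩ : SpanCat W) := rfl

theorem graph_comp {A B D : C} (f : A ⟶ B) (g : B ⟶ D) :
    graph W (f ≫ g) = graph W f ≫ graph W g :=
  cls_eq_of_homs (compLift (𝟙 A) f (by simp) (by simp) (by simp))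
    ⟨pullback.fst f (𝟙 B), rfl, by
      rw [← Category.assoc, pullback.condition, Category.comp_id]⟩

theorem graph_mem_maps {A B : C} (f : A ⟶ B) : maps (SpanCat W) (graph W f) := by
  constructor
  · exact cls_le_of_hom (A := ⟨A⟩) (B := ⟨A⟩) (s := Sp.id A)
      (t := Sp.comp (Sp.mk (𝟙 A) f) (Sp.mk f (𝟙 A)))
      (compLift (𝟙 A) (𝟙 A) rfl (by simp) (by simp))
  · exact cls_le_of_hom (A := ⟨B⟩) (B := ⟨B⟩) (t := Sp.id B)
      (s := Sp.comp (Sp.mk f (𝟙 A)) (Sp.mk (𝟙 A) f))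
      ⟨pullback.fst (𝟙 A) (𝟙 A) ≫ f, Category.comp_id _, by
        have h := pullback.condition (f := 𝟙 A) (g := 𝟙 A)
        rw [Category.comp_id, Category.comp_id] at h
        rw [Category.comp_id, h]⟩

/-- Monomorphisms in `W` have invertible graphs. -/
noncomputable def graphIso {A B : C} (g : A ⟶ B) [Mono g] (hg : W g) :
    (⟨A⟩ : SpanCat W) ≅ ⟨B⟩ where
  hom := graph W g
  inv := Allegory.recip (graph W g)
  hom_inv_id := cls_eq_of_homs (s := Sp.comp (Sp.mk (𝟙 A) g) (Sp.mk g (𝟙 A))) (t := Sp.id A)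
    ⟨pullback.fst g g, rfl, by
      have h : pullback.fst g g = pullback.snd g g := by rw [← cancel_mono g, pullback.condition]
      exact (Category.comp_id _).trans (h.trans (Category.comp_id _).symm)⟩
    (compLift (𝟙 A) (𝟙 A) rfl (by simp) (by simp))
  inv_hom_id := cls_eq (s := Sp.comp (Sp.mk g (𝟙 A)) (Sp.mk (𝟙 A) g)) (t := Sp.id B)
    (pullback.fst (𝟙 A) (𝟙 A) ≫ g) (Category.comp_id _)
    (by
      have h := pullback.condition (f := 𝟙 A) (g := 𝟙 A)
      rw [Category.comp_id, Category.comp_id] at h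
      rw [Category.comp_id, h])
    (W.comp_mem _ _ (hW.iso_mem _) hg)

theorem recip_graph_mem_maps {A B : C} (g : A ⟶ B) [Mono g] (hg : W g) :
    maps (SpanCat W) (Allegory.recip (graph W g)) := by
  constructor
  · rw [Allegory.recip_recip]
    exact (graphIso W g hg).inv_hom_id.ge
  · rw [Allegory.recip_recip]
    exact (graphIso W g hg).hom_inv_id.le

/-- The graph functor from the objects over `β` to the maps of `SpanCat W`. -/
def graphFunctor (β : C) : (below β).FullSubcategory ⥤ MapCat (SpanCat W) where
  obj A := ⟨⟨A.obj⟩⟩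
  map f := ⟨graph W f.hom, graph_mem_maps W f.hom⟩
  map_id A := WideSubcategory.hom_ext _ (graph_id W A.obj)
  map_comp f g := WideSubcategory.hom_ext _ (graph_comp W f.hom g.hom)

/-- `β × X → X` is a mono and a pullback of `β → 1`, so it lies in `W` and its graph is invertible.
-/
theorem essSurj_graphFunctor (β : C) (hβ : ∀ ⦃T : C⦄ (f g : T ⟶ β), f = g)
    (hβW : W (terminal.from β)) : (graphFunctor W β).EssSurj where
  mem_essImage X := by
    have : Mono (prod.snd : β ⨯ X.obj.obj ⟶ X.obj.obj) :=
      ⟨fun w w' h => Limits.prod.hom_ext (hβ _ _) h⟩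
    have hsnd : W (prod.snd : β ⨯ X.obj.obj ⟶ X.obj.obj) := by
      have sq : IsPullback (prod.fst : β ⨯ X.obj.obj ⟶ β) prod.snd (terminal.from β)
          (terminal.from X.obj.obj) := IsPullback.of_hasBinaryProduct' _ _
      exact W.of_isPullback sq hβW
    exact ⟨⟨β ⨯ X.obj.obj, ⟨prod.fst⟩⟩, ⟨WideSubcategory.isoMk (graphIso W prod.snd hsnd)
      (graph_mem_maps W _) (recip_graph_mem_maps W _ hsnd)⟩⟩

end Graphs

section FullyFaithful

variable {C : Type u} [Category.{v} C] [HasFiniteLimits C] {W : MorphismProperty C}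

/-- Over `β`, equivalent spans factor through the same relations. -/
theorem factors_iff_of_cls_eq {β : C} (hβW : W ≤ coveringAbove β) {A B : C} (c : A ⟶ β)
    {s t : Sp A B} (h : cls W s = cls W t) {U : C} (u : U ⟶ A ⨯ B) [Mono u] :
    (∃ l, l ≫ u = prod.lift s.l s.r) ↔ ∃ l, l ≫ u = prod.lift t.l t.r := by
  have key : ∀ s t : Sp A B, Sp.Le W s t →
      (∃ l, l ≫ u = prod.lift s.l s.r) = ∃ l, l ≫ u = prod.lift t.l t.r := by
    rintro s t ⟨x, hx⟩
    have e : prod.lift s.l s.r = x.hom ≫ prod.lift t.l t.r := by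
      rw [prod.comp_lift, x.hom_l, x.hom_r]
    refine propext ⟨?_, ?_⟩
    · rintro ⟨l, hl⟩
      -- The apex of `t` lies over β through `A`, so `x` covers it and membership in `u` descends.
      refine exists_lift_of_covers u _ ((hβW _ hx (t.l ≫ c) (𝟙 _)).mono ?_)
      rintro T τ ⟨y, hy⟩
      exact ⟨y ≫ l, by rw [Category.assoc, hl, e, ← Category.assoc, hy, Category.comp_id]⟩
    · rintro ⟨l, hl⟩
      exact ⟨x.hom ≫ l, by rw [Category.assoc, hl, e]⟩
  exact iff_of_eq (congrArg (Quot.lift (fun s : Sp A B => ∃ l, l ≫ u = prod.lift s.l s.r) key) h)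

theorem factors_of_cls_le [IsLogicalClass W] {β : C} (hβW : W ≤ coveringAbove β) {A B : C}
    (c : A ⟶ β) {s t : Sp A B}
    (h : (show (⟨A⟩ : SpanCat W) ⟶ ⟨B⟩ from cls W s) ≤ cls W t) {U : C} (u : U ⟶ A ⨯ B) [Mono u]
    (ht : ∃ l, l ≫ u = prod.lift t.l t.r) : ∃ l, l ≫ u = prod.lift s.l s.r := by
  obtain ⟨s', t', hs', ht', ⟨x⟩⟩ := exists_hom_of_le h
  rw [← factors_iff_of_cls_eq hβW c hs']
  obtain ⟨l, hl⟩ := (factors_iff_of_cls_eq hβW c ht' u).2 ht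
  exact ⟨x.hom ≫ l, by rw [Category.assoc, hl, prod.comp_lift, x.hom_l, x.hom_r]⟩

/-- Testing the equality of classes on the graph of `f`, itself a mono, forces the graph of `g` into
it. -/
theorem faithful_graphFunctor [IsLogicalClass W] {β : C} (hβW : W ≤ coveringAbove β) :
    (graphFunctor W β).Faithful where
  map_injective {A B f g} h := by
    have h' : cls W (Sp.mk (𝟙 A.obj) f.hom) = cls W (Sp.mk (𝟙 A.obj) g.hom) :=
      congrArg InducedWideCategory.Hom.hom h
    have : Mono (prod.lift (𝟙 A.obj) f.hom) := by
      have : Mono (prod.lift (𝟙 A.obj) f.hom ≫ prod.fst) := by rw [prod.lift_fst]; infer_instance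
      exact mono_of_mono _ prod.fst
    obtain ⟨l, hl⟩ := (factors_iff_of_cls_eq hβW A.property.some h'
      (prod.lift (𝟙 A.obj) f.hom)).1 ⟨𝟙 _, Category.id_comp _⟩
    have h₁ := hl =≫ prod.fst
    have h₂ := hl =≫ prod.snd
    rw [Category.assoc, prod.lift_fst, prod.lift_fst, Category.comp_id] at h₁
    rw [Category.assoc, prod.lift_snd, prod.lift_snd, h₁, Category.id_comp] at h₂
    exact ObjectProperty.hom_ext _ h₂

end FullyFaithful

section Full

variable {C : Type u} [Category.{v} C] [IsElementaryTopos C] {W : MorphismProperty C}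
  [hW : IsLogicalClass W]

/-- Every span is equivalent to a relation. -/
theorem exists_jointly_mono {A B : C} (s : Sp A B) :
    ∃ t : Sp A B, Mono (prod.lift t.l t.r) ∧ cls W t = cls W s := by
  obtain ⟨R, e, m, _, he, hcov⟩ := exists_image (prod.lift s.l s.r)
  have h₁ := he =≫ prod.fst
  have h₂ := he =≫ prod.snd
  rw [Category.assoc, prod.lift_fst] at h₁
  rw [Category.assoc, prod.lift_snd] at h₂
  have : Epi e := by
    refine epi_of_covers e ((hcov (𝟙 R)).mono ?_)
    rintro T t ⟨c, hc⟩
    refine ⟨c, ?_⟩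
    rw [← cancel_mono m, Category.assoc, he, hc, Category.id_comp]
  refine ⟨Sp.mk (m ≫ prod.fst) (m ≫ prod.snd), ?_, ?_⟩
  · change Mono (prod.lift (m ≫ prod.fst) (m ≫ prod.snd))
    rwa [← prod_lift_eq m]
  · exact (cls_eq e h₁ h₂ (hW.epi_mem e)).symm

/-- For a relation `(l, r)`, entireness makes `l` epi and simplicity makes it mono. Hence `l` is
invertible and the relation is the graph of `inv l ≫ r`. -/
theorem exists_graph_eq {β : C} (hβW : W ≤ coveringAbove β) {A B : C} (cA : A ⟶ β) (cB : B ⟶ β)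
    (φ : (⟨A⟩ : SpanCat W) ⟶ ⟨B⟩) (hφ : maps (SpanCat W) φ) : ∃ f : A ⟶ B, graph W f = φ := by
  have := IsElementaryTopos.hasSubobjectClassifier (C := C)
  obtain ⟨s, rfl⟩ : ∃ s : Sp A B, cls W s = φ := Quot.exists_rep φ
  obtain ⟨t, ht, hts⟩ := exists_jointly_mono (W := W) s
  obtain ⟨D, l, r, _, _⟩ := t
  rw [← hts] at hφ ⊢
  obtain ⟨h₁, h₂⟩ := hφ
  have : Epi l := by
    refine epi_of_covers l fun V v _ hv => ?_
    obtain ⟨l', hl'⟩ := hv l ⟨𝟙 D, Category.id_comp l⟩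
    -- If `l` factors through `v`, the relation followed by its opposite lies in `v × 1`; hence so
    -- does the diagonal of `A`, and `v` has a section.
    obtain ⟨k, hk⟩ := factors_of_cls_le hβW cA (s := Sp.id A)
      (t := Sp.comp (Sp.mk l r) (Sp.mk r l)) h₁ (prod.map v (𝟙 A))
      ⟨prod.lift (pullback.fst r r ≫ l') (pullback.snd r r ≫ l), by
        rw [prod.lift_map, Category.assoc, hl', Category.comp_id]⟩
    have h := hk =≫ prod.fst
    rw [Category.assoc, prod.map_fst, prod.lift_fst, ← Category.assoc] at h
    exact isIso_of_mono_of_section v ⟨_, h⟩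
  have : Mono l := by
    refine ⟨fun {T} a b hab => ?_⟩
    -- Simplicity tested against the diagonal: elements of `D` with equal `l` have equal `r`.
    obtain ⟨k, hk⟩ := factors_of_cls_le hβW cB (t := Sp.id B)
      (s := Sp.comp (Sp.mk r l) (Sp.mk l r)) h₂ (diag B) ⟨𝟙 B, Category.id_comp _⟩
    have e₁ := hk =≫ prod.fst
    have e₂ := hk =≫ prod.snd
    rw [Category.assoc, prod.lift_fst, prod.lift_fst, Category.comp_id] at e₁
    rw [Category.assoc, prod.lift_snd, prod.lift_snd, Category.comp_id] at e₂
    have e₃ := pullback.lift a b hab ≫= (e₁.symm.trans e₂)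
    rw [← Category.assoc, ← Category.assoc, pullback.lift_fst, pullback.lift_snd] at e₃
    have : Mono (prod.lift l r) := ht
    rw [← cancel_mono (prod.lift l r), prod.comp_lift, prod.comp_lift, hab, e₃]
  have : IsIso l := isIso_of_mono_of_epi l
  exact ⟨inv l ≫ r, cls_eq (s := Sp.mk (𝟙 A) (inv l ≫ r)) (t := Sp.mk l r) (inv l)
    (IsIso.inv_hom_id l) rfl (hW.iso_mem _)⟩

theorem full_graphFunctor {β : C} (hβW : W ≤ coveringAbove β) : (graphFunctor W β).Full where
  map_surjective {A B} φ := by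
    obtain ⟨f, hf⟩ := exists_graph_eq hβW A.property.some B.property.some φ.hom φ.property
    exact ⟨ObjectProperty.homMk f, WideSubcategory.hom_ext _ hf⟩

end Full

end SpanCat

end SpanTopos

theorem mainTheorem2 {T : Type u} [Category.{v} T] [SpanTopos.IsElementaryTopos T] :
    SpanTopos.IsBooleanTopos
      (SpanTopos.MapCat (SpanTopos.SpanCat (SpanTopos.boolClass T))) := by
  obtain ⟨⟨K⟩⟩ := SpanTopos.IsElementaryTopos.hasSubobjectClassifier (C := T)
  obtain ⟨β, S, b, hβ, hβW, hWβ, _, hb, hdec⟩ := SpanTopos.exists_decidability T K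
  have := SpanTopos.isBooleanTopos_below β hβ K b hb hdec
  have := SpanTopos.SpanCat.essSurj_graphFunctor (SpanTopos.boolClass T) β hβ hβW
  have := SpanTopos.SpanCat.faithful_graphFunctor hWβ
  have := SpanTopos.SpanCat.full_graphFunctor hWβ
  have : (SpanTopos.SpanCat.graphFunctor (SpanTopos.boolClass T) β).IsEquivalence := { }
  exact SpanTopos.isBooleanTopos_of_equivalence
    (SpanTopos.SpanCat.graphFunctor (SpanTopos.boolClass T) β).asEquivalence
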